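/- For a finite group $G$ and $u\in G$ let $\theta_u\colon G\to G$ be the map $\theta_u(g)=[g^{-u},g]$, where $[x,y]=x^{-1}y^{-1}xy$, $x^y=y^{-1}xy$ and $g^{-u}=(g^{-1})^u$. Let $\Theta_G(u)=\{g\in G \mid \theta_u^n(g)=g \text{ for some } n>0\}$; the map $\theta_u$ permutes $\Theta_G(u)$, and $\{1\}$ is one of its orbits. Let $\beta_G(u)$ be the number of orbits of $\theta_u$ on $\Theta_G(u)$ other than $\{1\}$. Lemma 5. Let $q\ge 4$ be a prime power, and let $G=\mathrm{SL}_2(q)$ or $G=\mathrm{L}_2(q)=\mathrm{SL}_2(q)/\mathrm{Z}(\mathrm{SL}_2(q))$. If $\kappa$ is a real number such that $\beta_G(u)\le\kappa$ for every $u\in G$ of order $2$ or $4$, then $|\mathrm{Aut}(G)|\le\kappa^7$. Moreover, let $u_0\in G$ be the matrix $\begin{pmatrix}0&1\\-1&0\end{pmatrix}$ if $G=\mathrm{SL}_2(q)$, and its image if $G=\mathrm{L}_2(q)$. Then $\beta_G(u_0)\ge\frac12(q-2)$ if $q$ is even, and $\beta_G(u_0)\ge\frac14(q-5)$ if $q$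 is odd. -/

import Mathlib

namespace EventualOrbit

/-- Right conjugation `x ^ y = y⁻¹ x y`. -/
def conjBy {G : Type*} [Group G] (x y : G) : G := y⁻¹ * x * y

/-- The commutator `[x, y] = x⁻¹ y⁻¹ x y` (Mathlib's `⁅x, y⁆` is `x y x⁻¹ y⁻¹`). -/
def commut {G : Type*} [Group G] (x y : G) : G := x⁻¹ * y⁻¹ * x * y

/-- The map `θ_u : G → G`, `θ_u(g) = [g^{-u}, g]`, where `g^{-u} = (g⁻¹)^u`. -/
def theta {G : Type*} [Group G] (u g : G) : G := commut (conjBy g⁻¹ u) g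

/-- `Θ_G(u)`, the set of all `g` with `θ_u^n(g) = g` for some `n > 0`. -/
def Theta {G : Type*} [Group G] (u : G) : Set G :=
  {g | ∃ n : ℕ, 0 < n ∧ (theta u)^[n] g = g}

/-- The orbit of `g` under `θ_u`. For `g ∈ Θ_G(u)` the forward iterates are the whole orbit of `g`
under the permutation that `θ_u` induces on `Θ_G(u)`. -/
def orbit {G : Type*} [Group G] (u g : G) : Set G :=
  {h | ∃ n : ℕ, h = (theta u)^[n] g}

/-- The eventual orbits of `θ_u`: the orbits of `θ_u` on `Θ_G(u)` other than `{1}`. -/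
def eventualOrbits {G : Type*} [Group G] (u : G) : Set (Set G) :=
  {O | (∃ g ∈ Theta u, O = orbit u g) ∧ O ≠ {1}}

/-- `β_G(u)`, the number of eventual orbits of `θ_u` (for a finite group `G`). -/
noncomputable def beta {G : Type*} [Group G] (u : G) : ℕ := (eventualOrbits u).ncard

/-- The matrix with rows `(0, 1)` and `(-1, 0)`, as an element of `SL₂(F)`. -/
def stdElt (F : Type*) [Field F] : Matrix.SpecialLinearGroup (Fin 2) F :=
  ⟨!![0, 1; -1, 0], by simp [Matrix.det_fin_two]⟩

/-- The image of `stdElt F` in `L₂(F) = SL₂(F) / Z(SL₂(F))`. -/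
def projStdElt (F : Type*) [Field F] : Matrix.ProjectiveSpecialLinearGroup (Fin 2) F :=
  QuotientGroup.mk (stdElt F)

end EventualOrbit

/-! For `u = stdElt F` the element `g^{-u}` is the transpose of `g`, so `θ_u(g) = (g gᵀ)⁻¹ (gᵀ g)`.
Describe `g` by its trace `τ`, the difference `σ` of its off-diagonal entries, and its trace-free
symmetric part `v`. Write `ν` for the norm of `v`; since `det g = 1`, `ν = τ² + σ² - 4`. Then `θ_u`
sends `τ` to `2 + σ²ν`, `σ` to `-στν`, and `v` to `(ν + 2)σ` times its quarter turn (`trace_theta`,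
`skew_theta`, `symPart_theta`).

For odd `q` the direction of `v` is therefore invariant up to a quarter turn, and the condition
"`-2ν` is a nonsquare, `σ ≠ 0`, `τ ≠ 0`" persists. Fixing `τ`, `σ` and `ν`, and letting `v` run over
a conic, gives at least `q - 2` starting points, of which at most four share an eventual orbit. For
even `q` the ratio `τ/σ` is inverted at each step, and its `q - 2` values other than `0` and `1`
give orbits shared by at most two. Passing to a central quotient does not decrease `β`
(`beta_le_beta_map`), because `θ_u(g)` depends only on `g` modulo the centre.

Against this stands `|Aut G| ≤ (q+1) q (q-1) |Aut F|` (`card_mulAut_le`). The image `U` of the upper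
unitriangular group is a Sylow subgroup, so inner automorphisms adjust any automorphism to preserve
both `U` and the lower unitriangular image. Such an automorphism acts on `U` as a scalar times a
field automorphism, and is determined by that action. Comparing with `β^7` is arithmetic for large
`q`; for `q = 4, 5, 7, 9` the orbit bound is too weak and explicit cycles replace it. -/

namespace EventualOrbit

/-! ### Iteration of `θ_u` in an arbitrary group, and central quotients. -/

section General

variable {G H : Type*} [Group G] [Group H]

theorem theta_one (u : G) : theta u 1 = 1 := by
  simp [theta, commut, conjBy]

theorem map_theta (f : G →* H) (u g : G) : f (theta u g) = theta (f u) (f g) := by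
  simp [theta, commut, conjBy]

theorem map_theta_iterate (f : G →* H) (u g : G) (n : ℕ) :
    f ((theta u)^[n] g) = (theta (f u))^[n] (f g) := by
  induction n with
  | zero => rfl
  | succ n ih => rw [Function.iterate_succ_apply', Function.iterate_succ_apply', map_theta, ih]

/-- A central factor of `g` cancels in the commutator. -/
theorem theta_mul_of_mem_center (u g : G) {z : G} (hz : z ∈ Subgroup.center G) :
    theta u (z * g) = theta u g := by
  have h : ∀ x, x * z = z * x := Subgroup.mem_center_iff.1 hz
  have h' : ∀ x, x * z⁻¹ = z⁻¹ * x := Subgroup.mem_center_iff.1 (inv_mem hz)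
  have h1 : conjBy (z * g)⁻¹ u = z⁻¹ * conjBy g⁻¹ u := by
    simp only [conjBy, mul_inv_rev, ← mul_assoc, ← h']
    simp only [mul_assoc, ← h']
  rw [theta, h1, theta]
  generalize conjBy g⁻¹ u = x
  calc (z⁻¹ * x)⁻¹ * (z * g)⁻¹ * (z⁻¹ * x) * (z * g)
      = x⁻¹ * (z * g⁻¹) * (z⁻¹ * z⁻¹) * (x * z) * g := by
        simp only [mul_inv_rev, inv_inv, mul_assoc]
    _ = x⁻¹ * (g⁻¹ * z) * (z⁻¹ * z⁻¹) * (z * x) * g := by rw [h, h]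
    _ = x⁻¹ * g⁻¹ * x * g := by group

theorem mem_orbit_self (u g : G) : g ∈ orbit u g := ⟨0, rfl⟩

theorem orbit_theta {u g : G} (hg : g ∈ Theta u) : orbit u (theta u g) = orbit u g := by
  obtain ⟨n, hn, h⟩ := hg
  ext x
  constructor
  · rintro ⟨m, rfl⟩
    exact ⟨m + 1, by rw [Function.iterate_succ_apply]⟩
  · rintro ⟨m, rfl⟩
    -- Going `n - 1` steps further round the period undoes the extra application of `θ_u`.
    refine ⟨m + (n - 1), ?_⟩
    rw [← Function.iterate_succ_apply, Nat.succ_eq_add_one, add_assoc, Nat.sub_add_cancel hn,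
      Function.iterate_add_apply, h]

theorem theta_iterate_mem_Theta {u g : G} (hg : g ∈ Theta u) (m : ℕ) :
    (theta u)^[m] g ∈ Theta u := by
  obtain ⟨n, hn, h⟩ := hg
  exact ⟨n, hn, by rw [← Function.iterate_add_apply, add_comm, Function.iterate_add_apply, h]⟩

theorem orbit_theta_iterate {u g : G} (hg : g ∈ Theta u) (m : ℕ) :
    orbit u ((theta u)^[m] g) = orbit u g := by
  induction m with
  | zero => rfl
  | succ m ih =>
    rw [Function.iterate_succ_apply', orbit_theta (theta_iterate_mem_Theta hg m), ih]

theorem exists_theta_iterate_mem_Theta [Finite G] (u g : G) :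
    ∃ n, (theta u)^[n] g ∈ Theta u := by
  obtain ⟨m, n, hmn, h⟩ := Finite.exists_ne_map_eq_of_infinite fun n : ℕ => (theta u)^[n] g
  wlog hlt : m < n generalizing m n
  · exact this n m hmn.symm h.symm (by omega)
  refine ⟨m, n - m, by omega, ?_⟩
  rw [← Function.iterate_add_apply, Nat.sub_add_cancel hlt.le]
  exact h.symm

/-- Forward orbits that never reach `1`, and that meet only in families of at most `N` members,
bound the number of eventual orbits from below. -/
theorem card_le_mul_beta [Finite G] {ι : Type*} [Finite ι] (u : G) (g : ι → G) (N : ℕ)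
    (hne : ∀ i n, (theta u)^[n] (g i) ≠ 1) (S : ι → Set ι) (hS : ∀ i, (S i).ncard ≤ N)
    (h : ∀ i j m n, (theta u)^[m] (g i) = (theta u)^[n] (g j) → j ∈ S i) :
    Nat.card ι ≤ N * beta u := by
  classical
  have := Fintype.ofFinite ι
  -- Each forward orbit enters a cycle after finitely many steps; `f` records that cycle, and its
  -- fibres lie in the sets `S i`.
  choose e he using fun i => exists_theta_iterate_mem_Theta u (g i)
  let f : ι → Set G := fun i => orbit u ((theta u)^[e i] (g i))
  have hf : ∀ i, f i ∈ eventualOrbits u := fun i => by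
    refine ⟨⟨_, he i, rfl⟩, fun h1 => hne i (e i) ?_⟩
    have := mem_orbit_self u ((theta u)^[e i] (g i))
    rw [show orbit u ((theta u)^[e i] (g i)) = {1} from h1] at this
    exact this
  have hfib : ∀ i j, f j = f i → j ∈ S i := fun i j hij => by
    have := mem_orbit_self u ((theta u)^[e j] (g j))
    rw [show orbit u ((theta u)^[e j] (g j)) = orbit u ((theta u)^[e i] (g i)) from hij] at this
    obtain ⟨m, hm⟩ := this
    rw [← Function.iterate_add_apply] at hm
    exact h i j _ _ hm.symm
  have h1 : (Finset.univ : Finset ι).card ≤ N * (Finset.univ.image f).card := by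
    refine Finset.card_le_mul_card_image _ _ fun b hb => ?_
    obtain ⟨i, -, rfl⟩ := Finset.mem_image.1 hb
    refine le_trans ?_ (hS i)
    rw [← Set.ncard_coe_finset]
    exact Set.ncard_le_ncard (fun j hj => hfib i j (by simpa using hj)) (Set.toFinite _)
  rw [Nat.card_eq_fintype_card]
  refine h1.trans (Nat.mul_le_mul_left _ ?_)
  rw [beta, ← Set.ncard_coe_finset]
  refine Set.ncard_le_ncard ?_ (Set.toFinite _)
  intro b hb
  obtain ⟨i, -, rfl⟩ := Finset.mem_image.1 (Finset.mem_coe.1 hb)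
  exact hf i

/-- Taking images of orbits is injective: if `f g = f h` then `g` and `h` have the same image under
`θ_u`, hence the same orbit when both are periodic. For the same reason only the trivial orbit maps
to `{1}`. -/
theorem beta_le_beta_map [Finite G] [Finite H] (f : G →* H)
    (hker : f.ker ≤ Subgroup.center G) (u : G) : beta u ≤ beta (f u) := by
  have hlift : ∀ {g h : G}, f g = f h → theta u g = theta u h := fun {g h} hgh => by
    have : g * h⁻¹ ∈ Subgroup.center G := hker (by simp [MonoidHom.mem_ker, hgh])
    rw [← theta_mul_of_mem_center u h this, inv_mul_cancel_right]
  have himg : ∀ g, f '' orbit u g = orbit (f u) (f g) := fun g => by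
    ext x
    constructor
    · rintro ⟨_, ⟨n, rfl⟩, rfl⟩
      exact ⟨n, map_theta_iterate f u g n⟩
    · rintro ⟨n, rfl⟩
      exact ⟨_, ⟨n, rfl⟩, map_theta_iterate f u g n⟩
  refine Set.ncard_le_ncard_of_injOn (fun O => f '' O) ?_ ?_ (Set.toFinite _)
  · rintro _ ⟨⟨g, ⟨n, hn, hg⟩, rfl⟩, hne⟩
    refine ⟨⟨f g, ⟨n, hn, ?_⟩, himg g⟩, fun h1 => hne ?_⟩
    · rw [← map_theta_iterate, hg]
    · have h2 : f g = f 1 := by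
        have : f g ∈ f '' orbit u g := ⟨g, mem_orbit_self u g, rfl⟩
        simpa [show f '' orbit u g = {1} from h1] using this
      have h3 := hlift h2
      rw [theta_one] at h3
      rw [← orbit_theta ⟨n, hn, hg⟩, h3]
      ext x
      simp only [orbit, Set.mem_ofPred_eq, Set.mem_singleton_iff,
        Function.iterate_fixed (theta_one u), exists_const]
  · rintro _ ⟨⟨g, hg, rfl⟩, -⟩ _ ⟨⟨h, hh, rfl⟩, -⟩ heq
    have : f h ∈ f '' orbit u g := by
      rw [show f '' orbit u g = f '' orbit u h from heq]
      exact ⟨h, mem_orbit_self u h, rfl⟩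
    obtain ⟨_, ⟨n, rfl⟩, hn⟩ := this
    rw [← orbit_theta hh, ← hlift hn, orbit_theta (theta_iterate_mem_Theta hg n),
      orbit_theta_iterate hg]

end General

/-! ### `θ` in terms of trace, skew part and symmetric part. -/

section Dynamics

open Matrix

variable {F : Type*} [Field F]

/-- The element of `SL₂(F)` with the given entries. -/
def ofEntries (a b c d : F) (h : a * d - b * c = 1) : SpecialLinearGroup (Fin 2) F :=
  ⟨!![a, b; c, d], by rw [det_fin_two_of, h]⟩

theorem det_entries (g : SpecialLinearGroup (Fin 2) F) :
    g.1 0 0 * g.1 1 1 - g.1 0 1 * g.1 1 0 = 1 := by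
  rw [← det_fin_two, g.2]

theorem exists_ofEntries (g : SpecialLinearGroup (Fin 2) F) :
    ∃ a b c d h, g = ofEntries a b c d h :=
  ⟨_, _, _, _, det_entries g, Subtype.ext (eta_fin_two g.1)⟩

theorem ofEntries_inj {a b c d a' b' c' d' : F} {h h'} :
    ofEntries a b c d h = ofEntries a' b' c' d' h' ↔ a = a' ∧ b = b' ∧ c = c' ∧ d = d' := by
  constructor
  · intro e
    have e1 := congrArg Subtype.val e
    exact ⟨congrFun (congrFun e1 0) 0, congrFun (congrFun e1 0) 1, congrFun (congrFun e1 1) 0,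
      congrFun (congrFun e1 1) 1⟩
  · rintro ⟨rfl, rfl, rfl, rfl⟩
    rfl

theorem one_eq_ofEntries :
    (1 : SpecialLinearGroup (Fin 2) F) = ofEntries 1 0 0 1 (by ring) :=
  Subtype.ext one_fin_two

theorem ofEntries_mul {a b c d a' b' c' d' : F} (h h') :
    ofEntries a b c d h * ofEntries a' b' c' d' h' =
      ofEntries (a * a' + b * c') (a * b' + b * d') (c * a' + d * c') (c * b' + d * d')
        (by linear_combination (a' * d' - b' * c') * h + h') :=
  Subtype.ext (mul_fin_two _ _ _ _ _ _ _ _)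

theorem ofEntries_inv {a b c d : F} (h) :
    (ofEntries a b c d h)⁻¹ = ofEntries d (-b) (-c) a (by linear_combination h) :=
  Subtype.ext (adjugate_fin_two_of _ _ _ _)

theorem stdElt_eq_ofEntries : stdElt F = ofEntries 0 1 (-1) 0 (by ring) := rfl

theorem det_theta_entries {a b c d : F} (h : a * d - b * c = 1) :
    ((c ^ 2 + d ^ 2) * (a ^ 2 + c ^ 2) - (a * c + b * d) * (a * b + c * d)) *
      ((a ^ 2 + b ^ 2) * (b ^ 2 + d ^ 2) - (a * c + b * d) * (a * b + c * d)) -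
    ((c ^ 2 + d ^ 2) * (a * b + c * d) - (a * c + b * d) * (b ^ 2 + d ^ 2)) *
      ((a ^ 2 + b ^ 2) * (a * b + c * d) - (a * c + b * d) * (a ^ 2 + c ^ 2)) = 1 := by
  have e : ((c ^ 2 + d ^ 2) * (a ^ 2 + c ^ 2) - (a * c + b * d) * (a * b + c * d)) *
      ((a ^ 2 + b ^ 2) * (b ^ 2 + d ^ 2) - (a * c + b * d) * (a * b + c * d)) -
    ((c ^ 2 + d ^ 2) * (a * b + c * d) - (a * c + b * d) * (b ^ 2 + d ^ 2)) *
      ((a ^ 2 + b ^ 2) * (a * b + c * d) - (a * c + b * d) * (a ^ 2 + c ^ 2)) =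
      (a * d - b * c) ^ 4 := by ring
  rw [e, h, one_pow]

/-- Conjugating an inverse by `stdElt F` gives the transpose, so these are the entries of `(g gᵀ)⁻¹
(gᵀ g)`. -/
theorem theta_stdElt_ofEntries {a b c d : F} (h : a * d - b * c = 1) :
    theta (stdElt F) (ofEntries a b c d h) = ofEntries
      ((c ^ 2 + d ^ 2) * (a ^ 2 + c ^ 2) - (a * c + b * d) * (a * b + c * d))
      ((c ^ 2 + d ^ 2) * (a * b + c * d) - (a * c + b * d) * (b ^ 2 + d ^ 2))
      ((a ^ 2 + b ^ 2) * (a * b + c * d) - (a * c + b * d) * (a ^ 2 + c ^ 2))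
      ((a ^ 2 + b ^ 2) * (b ^ 2 + d ^ 2) - (a * c + b * d) * (a * b + c * d))
      (det_theta_entries h) := by
  simp only [theta, commut, conjBy, stdElt_eq_ofEntries, ofEntries_inv, ofEntries_mul,
    ofEntries_inj]
  refine ⟨?_, ?_, ?_, ?_⟩ <;> ring

/-- The difference of the off-diagonal entries. -/
def skew (g : SpecialLinearGroup (Fin 2) F) : F := g.1 0 1 - g.1 1 0

/-- The trace-free symmetric part of a matrix, up to a factor `2`. -/
def symPart (g : SpecialLinearGroup (Fin 2) F) : F × F :=
  (g.1 0 0 - g.1 1 1, g.1 0 1 + g.1 1 0)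

/-- The quadratic form `x² + y²`. -/
def normSq (v : F × F) : F := v.1 ^ 2 + v.2 ^ 2

/-- Rotation by a quarter turn. -/
def quarterTurn (v : F × F) : F × F := (-v.2, v.1)

theorem normSq_smul (r : F) (v : F × F) : normSq (r • v) = r ^ 2 * normSq v := by
  simp only [normSq, Prod.smul_fst, Prod.smul_snd, smul_eq_mul]
  ring

theorem normSq_quarterTurn (v : F × F) : normSq (quarterTurn v) = normSq v := by
  simp only [normSq, quarterTurn]
  ring

theorem quarterTurn_smul (r : F) (v : F × F) : quarterTurn (r • v) = r • quarterTurn v := by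
  simp [quarterTurn]

theorem quarterTurn_quarterTurn (v : F × F) : quarterTurn (quarterTurn v) = -v := rfl

theorem normSq_symPart (g : SpecialLinearGroup (Fin 2) F) :
    normSq (symPart g) = g.1.trace ^ 2 + skew g ^ 2 - 4 := by
  have := det_entries g
  simp only [normSq, symPart, skew, trace_fin_two]
  linear_combination -4 * this

theorem trace_theta (g : SpecialLinearGroup (Fin 2) F) :
    (theta (stdElt F) g).1.trace = 2 + skew g ^ 2 * normSq (symPart g) := by
  obtain ⟨a, b, c, d, h, rfl⟩ := exists_ofEntries g
  rw [theta_stdElt_ofEntries]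
  simp only [ofEntries, trace_fin_two_of, skew, symPart, normSq, of_apply, cons_val', cons_val_zero,
    cons_val_one, cons_val_fin_one]
  grind

theorem skew_theta (g : SpecialLinearGroup (Fin 2) F) :
    skew (theta (stdElt F) g) = -(skew g * g.1.trace * normSq (symPart g)) := by
  obtain ⟨a, b, c, d, h, rfl⟩ := exists_ofEntries g
  rw [theta_stdElt_ofEntries]
  simp only [ofEntries, trace_fin_two_of, skew, symPart, normSq, of_apply, cons_val', cons_val_zero,
    cons_val_one, cons_val_fin_one]
  grind

theorem symPart_theta (g : SpecialLinearGroup (Fin 2) F) :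
    symPart (theta (stdElt F) g) =
      ((normSq (symPart g) + 2) * skew g) • quarterTurn (symPart g) := by
  obtain ⟨a, b, c, d, h, rfl⟩ := exists_ofEntries g
  rw [theta_stdElt_ofEntries]
  simp only [ofEntries, skew, symPart, normSq, quarterTurn, of_apply, cons_val', cons_val_zero,
    cons_val_one, cons_val_fin_one, Prod.smul_mk, smul_eq_mul, Prod.mk.injEq]
  constructor <;> grind

theorem skew_one : skew (1 : SpecialLinearGroup (Fin 2) F) = 0 := by simp [skew]

/-- In odd characteristic this condition is preserved by `θ` and keeps forward orbits away
from `1`. -/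
structure IsPersistent (g : SpecialLinearGroup (Fin 2) F) : Prop where
  skew_ne : skew g ≠ 0
  trace_ne : g.1.trace ≠ 0
  not_isSquare : ¬ IsSquare (-2 * normSq (symPart g))

namespace IsPersistent

variable {g : SpecialLinearGroup (Fin 2) F}

theorem normSq_ne (hg : IsPersistent g) : normSq (symPart g) ≠ 0 := fun h =>
  hg.not_isSquare ⟨0, by rw [h]; ring⟩

theorem scalar_ne (hg : IsPersistent g) : (normSq (symPart g) + 2) * skew g ≠ 0 := by
  refine mul_ne_zero (fun h => hg.not_isSquare ⟨2, ?_⟩) hg.skew_ne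
  rw [eq_neg_of_add_eq_zero_left h]
  ring

/-- A vanishing new trace would give `-2ν = (2/σ)²`, and `ν = -2` would give `-2ν = 2²`. Otherwise
`ν` is multiplied by a nonzero square, so its class is kept. -/
theorem theta (hg : IsPersistent g) : IsPersistent (theta (stdElt F) g) where
  skew_ne := by
    rw [skew_theta]
    exact neg_ne_zero.2 (mul_ne_zero (mul_ne_zero hg.skew_ne hg.trace_ne) hg.normSq_ne)
  trace_ne h := by
    rw [trace_theta] at h
    refine hg.not_isSquare ⟨2 / skew g, ?_⟩
    have := hg.skew_ne
    field_simp
    linear_combination -2 * h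
  not_isSquare := by
    rw [symPart_theta, normSq_smul, normSq_quarterTurn]
    rintro ⟨r, hr⟩
    refine hg.not_isSquare ⟨r / ((normSq (symPart g) + 2) * skew g), ?_⟩
    have := hg.scalar_ne
    rw [div_mul_div_comm, eq_div_iff (mul_ne_zero this this), ← hr]
    ring

theorem iterate (hg : IsPersistent g) (n : ℕ) :
    IsPersistent ((EventualOrbit.theta (stdElt F))^[n] g) := by
  induction n with
  | zero => exact hg
  | succ n ih => rw [Function.iterate_succ_apply']; exact ih.theta

theorem ne_one (hg : IsPersistent g) : g ≠ 1 := by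
  rintro rfl
  exact hg.skew_ne skew_one

theorem symPart_iterate (hg : IsPersistent g) (n : ℕ) :
    ∃ r : F, r ≠ 0 ∧ (symPart ((EventualOrbit.theta (stdElt F))^[n] g) = r • symPart g ∨
      symPart ((EventualOrbit.theta (stdElt F))^[n] g) = r • quarterTurn (symPart g)) := by
  induction n with
  | zero => exact ⟨1, one_ne_zero, Or.inl (one_smul _ _).symm⟩
  | succ n ih =>
    obtain ⟨r, hr, h⟩ := ih
    rw [Function.iterate_succ_apply', symPart_theta]
    have hs := (hg.iterate n).scalar_ne
    generalize (normSq (symPart ((EventualOrbit.theta (stdElt F))^[n] g)) + 2) *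
      skew ((EventualOrbit.theta (stdElt F))^[n] g) = t at hs
    rcases h with h | h
    · exact ⟨t * r, mul_ne_zero hs hr, Or.inr (by rw [h, quarterTurn_smul, mul_smul])⟩
    · refine ⟨-(t * r), neg_ne_zero.2 (mul_ne_zero hs hr), Or.inl ?_⟩
      rw [h, quarterTurn_smul, quarterTurn_quarterTurn, smul_neg, smul_neg, neg_smul, mul_smul]

/-- Two quarter turns are `-1`, so meeting orbits have symmetric parts that are parallel or
perpendicular. -/
theorem symPart_of_iterate_eq {h : SpecialLinearGroup (Fin 2) F} (hg : IsPersistent g)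
    (hh : IsPersistent h) {m n : ℕ}
    (e : (EventualOrbit.theta (stdElt F))^[m] g = (EventualOrbit.theta (stdElt F))^[n] h) :
    ∃ r : F, symPart h = r • symPart g ∨ symPart h = r • quarterTurn (symPart g) := by
  obtain ⟨r, -, h1⟩ := hg.symPart_iterate m
  obtain ⟨t, ht, h2⟩ := hh.symPart_iterate n
  rw [e] at h1
  rcases h2 with h2 | h2
  · have h3 : symPart h = t⁻¹ • symPart ((EventualOrbit.theta (stdElt F))^[n] h) := by
      rw [h2, inv_smul_smul₀ ht]
    refine ⟨t⁻¹ * r, h1.imp (fun h1 => ?_) fun h1 => ?_⟩ <;> rw [h3, h1, mul_smul]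
  · have h3 : symPart h =
        (-t⁻¹) • quarterTurn (symPart ((EventualOrbit.theta (stdElt F))^[n] h)) := by
      rw [h2, quarterTurn_smul, quarterTurn_quarterTurn, neg_smul, smul_neg, smul_neg, neg_neg,
        inv_smul_smul₀ ht]
    rcases h1 with h1 | h1
    · exact ⟨-t⁻¹ * r, Or.inr (by rw [h3, h1, quarterTurn_smul, mul_smul])⟩
    · exact ⟨-(-t⁻¹ * r), Or.inl (by
        rw [h3, h1, quarterTurn_smul, quarterTurn_quarterTurn, neg_smul (_ * _), mul_smul, smul_neg,
          smul_neg])⟩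

end IsPersistent

end Dynamics

/-! ### Lower bounds for `β` linear in `q`, in odd and in even characteristic. -/

section LowerBounds

open Matrix

variable {F : Type*} [Field F]

theorem trace_ofEntries {a b c d : F} (h : a * d - b * c = 1) :
    (ofEntries a b c d h).1.trace = a + d := trace_fin_two_of _ _ _ _

theorem skew_ofEntries {a b c d : F} (h : a * d - b * c = 1) :
    skew (ofEntries a b c d h) = b - c := rfl

theorem symPart_ofEntries {a b c d : F} (h : a * d - b * c = 1) :
    symPart (ofEntries a b c d h) = (a - d, b + c) := rfl

theorem exists_sq_add_sq_sub_eq_four [Finite F] (hq : 7 ≤ Nat.card F) (h2 : (2 : F) ≠ 0) (k : F) :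
    ∃ s y t : F, s ≠ 0 ∧ y ≠ 0 ∧ t ≠ 0 ∧ s ^ 2 + y ^ 2 - t ^ 2 * k = 4 := by
  open Polynomial in
  -- The quadric is parametrised by lines through its point `(2, 0, 0)` in direction `(-1, b, 1)`.
  -- The factors of this quintic keep `y`, `s` and the denominator nonzero; a non-root exists
  -- because `q > 5`.
  obtain ⟨b, hb⟩ : ∃ b : F, eval b (X * (X ^ 2 - C (k + 1)) * (X ^ 2 - C (k - 1))) ≠ 0 := by
    have hm : (X * (X ^ 2 - C (k + 1)) * (X ^ 2 - C (k - 1))).Monic :=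
      (monic_X.mul (monic_X_pow_sub_C _ two_ne_zero)).mul (monic_X_pow_sub_C _ two_ne_zero)
    refine exists_eval_ne_zero_of_natDegree_lt_card _ hm.ne_zero ?_
    have h5 : (X * (X ^ 2 - C (k + 1)) * (X ^ 2 - C (k - 1))).natDegree = 5 := by
      compute_degree!
    rw [h5, ← Nat.cast_card]
    exact_mod_cast (by omega : 5 < Nat.card F)
  simp only [Polynomial.eval_mul, Polynomial.eval_X, Polynomial.eval_sub, Polynomial.eval_pow,
    Polynomial.eval_C, mul_ne_zero_iff] at hb
  obtain ⟨⟨hb0, hb1⟩, hb2⟩ := hb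
  have hD : 1 + b ^ 2 - k ≠ 0 := fun h => hb2 (by linear_combination h)
  have hE : b ^ 2 - k - 1 ≠ 0 := fun h => hb1 (by linear_combination h)
  have h4 : (4 : F) ≠ 0 := by
    rw [show (4 : F) = 2 * 2 by norm_num]
    exact mul_ne_zero h2 h2
  refine ⟨2 * (b ^ 2 - k - 1) / (1 + b ^ 2 - k), 4 * b / (1 + b ^ 2 - k), 4 / (1 + b ^ 2 - k),
    div_ne_zero (mul_ne_zero h2 hE) hD, div_ne_zero (mul_ne_zero h4 hb0) hD, div_ne_zero h4 hD, ?_⟩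
  field_simp
  ring

theorem exists_sq_add_sq [Finite F] (hF : ringChar F ≠ 2) (k : F) :
    ∃ a b : F, a ^ 2 + b ^ 2 = k := by
  have := Fintype.ofFinite F
  open Polynomial in
  obtain ⟨a, b, h⟩ := FiniteField.exists_root_sum_quadratic (R := F) (f := X ^ 2)
    (g := X ^ 2 - C k) (degree_X_pow 2) (degree_X_pow_sub_C two_pos k)
    (FiniteField.odd_card_of_char_ne_two hF)
  refine ⟨a, b, ?_⟩
  simp only [Polynomial.eval_pow, Polynomial.eval_X, Polynomial.eval_sub, Polynomial.eval_C] at h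
  linear_combination h

theorem ncard_pair_le {α : Type*} (a b : α) : ({a, b} : Set α).ncard ≤ 2 :=
  (Set.ncard_insert_le _ _).trans (by simp)

theorem card_sub_two_le_card_sq_ne [Finite F] (c : F) :
    Nat.card F - 2 ≤ Nat.card {m : F // m ^ 2 ≠ c} := by
  have h1 : {m : F | m ^ 2 = c}.ncard ≤ 2 := by
    rcases Set.eq_empty_or_nonempty {m : F | m ^ 2 = c} with h | ⟨r, hr⟩
    · simp [h]
    · refine le_trans (Set.ncard_le_ncard (t := {r, -r}) (fun m hm => ?_) (Set.toFinite _))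
        (ncard_pair_le _ _)
      have : m ^ 2 = r ^ 2 := (show m ^ 2 = c from hm).trans (show r ^ 2 = c from hr).symm
      exact sq_eq_sq_iff_eq_or_eq_neg.1 this
  have h2 := Set.ncard_add_ncard_compl {m : F | m ^ 2 = c}
  have h3 : Nat.card {m : F // m ^ 2 ≠ c} = {m : F | m ^ 2 = c}ᶜ.ncard :=
    Nat.card_coe_set_eq {m : F | m ^ 2 = c}ᶜ
  omega

theorem card_sub_two_le_four_mul_beta [Finite F] (hF : ringChar F ≠ 2) (hq : 7 ≤ Nat.card F) :
    Nat.card F - 2 ≤ 4 * beta (stdElt F) := by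
  classical
  have h2 : (2 : F) ≠ 0 := Ring.two_ne_zero hF
  obtain ⟨e, he⟩ := FiniteField.exists_nonsquare hF
  obtain ⟨k, hk⟩ : ∃ k : F, -2 * k = e := ⟨e / -2, mul_div_cancel₀ _ (neg_ne_zero.2 h2)⟩
  have hk0 : k ≠ 0 := by
    rintro rfl
    exact he ⟨0, by rw [← hk]; ring⟩
  -- `s` will be the trace, `y` the skew part, and `t • v m` the symmetric part; the equation is
  -- then the determinant condition.
  obtain ⟨s, y, t, hs, hy, ht, hsyt⟩ := exists_sq_add_sq_sub_eq_four hq h2 k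
  obtain ⟨a, b, hab⟩ := exists_sq_add_sq hF k
  refine (card_sub_two_le_card_sq_ne (-1)).trans ?_
  -- The point `(a, b)` of the conic is rotated by the rational points of the unit circle with
  -- parameter `m`.
  let v : {m : F // m ^ 2 ≠ -1} → F × F := fun m =>
    (a * ((1 - m.1 ^ 2) / (1 + m.1 ^ 2)) - b * (2 * m.1 / (1 + m.1 ^ 2)),
      a * (2 * m.1 / (1 + m.1 ^ 2)) + b * ((1 - m.1 ^ 2) / (1 + m.1 ^ 2)))
  have hm : ∀ m : {m : F // m ^ 2 ≠ -1}, 1 + m.1 ^ 2 ≠ 0 := fun m h =>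
    m.2 (by linear_combination h)
  have hv : ∀ m, normSq (v m) = k := fun m => by
    have := hm m
    simp only [normSq, v]
    rw [← hab]
    field_simp
    ring
  have hinj : Function.Injective v := fun m n h => by
    have h1 := congrArg Prod.fst h
    have h2' := congrArg Prod.snd h
    simp only [v] at h1 h2'
    have hx : (1 - m.1 ^ 2) / (1 + m.1 ^ 2) = (1 - n.1 ^ 2) / (1 + n.1 ^ 2) := by
      apply mul_left_cancel₀ hk0
      rw [← hab]
      linear_combination a * h1 + b * h2'
    have hz : 2 * m.1 / (1 + m.1 ^ 2) = 2 * n.1 / (1 + n.1 ^ 2) := by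
      apply mul_left_cancel₀ hk0
      rw [← hab]
      linear_combination a * h2' - b * h1
    have hm1 := hm m
    have hn1 := hm n
    rw [div_eq_div_iff hm1 hn1] at hx hz
    have hsq : m.1 ^ 2 = n.1 ^ 2 := by
      apply mul_left_cancel₀ h2
      linear_combination -hx
    apply Subtype.ext
    apply mul_left_cancel₀ (mul_ne_zero h2 hm1)
    linear_combination hz + 2 * m.1 * hsq
  have hdet : ∀ m, (s + t * (v m).1) / 2 * ((s - t * (v m).1) / 2) -
      (t * (v m).2 + y) / 2 * ((t * (v m).2 - y) / 2) = 1 := fun m => by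
    have := hv m
    simp only [normSq] at this
    field_simp
    rw [← this] at hsyt
    linear_combination hsyt
  let g : {m : F // m ^ 2 ≠ -1} → SpecialLinearGroup (Fin 2) F := fun m =>
    ofEntries _ _ _ _ (hdet m)
  have hsym : ∀ m, symPart (g m) = t • v m := fun m => by
    rw [symPart_ofEntries]
    ext
    · rw [Prod.smul_fst, smul_eq_mul]
      field_simp
      ring
    · rw [Prod.smul_snd, smul_eq_mul]
      field_simp
      ring
  have hper : ∀ m, IsPersistent (g m) := fun m => by
    refine ⟨?_, ?_, ?_⟩
    · rw [skew_ofEntries]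
      convert hy using 1
      field_simp
      ring
    · rw [trace_ofEntries]
      convert hs using 1
      field_simp
      ring
    · rw [hsym, normSq_smul, hv]
      rintro ⟨r, hr⟩
      refine he ⟨r / t, ?_⟩
      rw [← hk]
      field_simp
      linear_combination hr
  refine card_le_mul_beta (stdElt F) g 4 (fun m n => ((hper m).iterate n).ne_one)
    (fun m => v ⁻¹' ({v m, -v m, quarterTurn (v m), -quarterTurn (v m)} : Finset (F × F)))
    (fun m => ?_) fun m n i j hij => ?_
  · refine le_trans (Set.ncard_le_ncard_of_injOn (t := (({v m, -v m, quarterTurn (v m),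
      -quarterTurn (v m)} : Finset (F × F)) : Set (F × F))) v (fun x hx => hx) hinj.injOn
      (Set.toFinite _)) ?_
    rw [Set.ncard_coe_finset]
    exact Finset.card_le_four
  · obtain ⟨r, h⟩ := (hper m).symPart_of_iterate_eq (hper n) hij
    have hr : v n = r • v m ∨ v n = r • quarterTurn (v m) := by
      rw [hsym, hsym, quarterTurn_smul, smul_comm r t, smul_comm r t] at h
      exact h.imp (fun h => smul_right_injective _ ht h) fun h => smul_right_injective _ ht h
    -- All `v m` have the same nonzero norm `k`, which leaves only `r = ±1` and hence four
    -- candidates.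
    have hr2 : r ^ 2 = 1 := by
      apply mul_right_cancel₀ hk0
      rw [one_mul]
      rcases hr with hr | hr
      · conv_rhs => rw [← hv n, hr, normSq_smul, hv]
      · conv_rhs => rw [← hv n, hr, normSq_smul, normSq_quarterTurn, hv]
    simp only [Finset.coe_insert, Finset.coe_singleton, Set.mem_preimage, Set.mem_insert_iff,
      Set.mem_singleton_iff]
    rcases mul_self_eq_one_iff.1 ((sq r).symm.trans hr2) with rfl | rfl <;>
    rcases hr with hr | hr <;> simp [hr]

/-- In characteristic two this condition is preserved by `θ` and keeps forward orbits away
from `1`. -/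
structure IsPersistentTwo (g : SpecialLinearGroup (Fin 2) F) : Prop where
  skew_ne : skew g ≠ 0
  trace_ne : g.1.trace ≠ 0
  trace_ne_skew : g.1.trace ≠ skew g

namespace IsPersistentTwo

variable {g : SpecialLinearGroup (Fin 2) F}

theorem normSq_symPart_eq (h2 : (2 : F) = 0) (g : SpecialLinearGroup (Fin 2) F) :
    normSq (symPart g) = (g.1.trace - skew g) ^ 2 := by
  rw [normSq_symPart]
  linear_combination (-2 + g.1.trace * skew g) * h2

theorem normSq_ne (h2 : (2 : F) = 0) (hg : IsPersistentTwo g) : normSq (symPart g) ≠ 0 := by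
  rw [normSq_symPart_eq h2]
  exact pow_ne_zero 2 (sub_ne_zero.2 hg.trace_ne_skew)

theorem theta (h2 : (2 : F) = 0) (hg : IsPersistentTwo g) :
    IsPersistentTwo (theta (stdElt F) g) where
  skew_ne := by
    rw [skew_theta]
    exact neg_ne_zero.2 (mul_ne_zero (mul_ne_zero hg.skew_ne hg.trace_ne) (hg.normSq_ne h2))
  trace_ne := by
    rw [trace_theta, h2, zero_add]
    exact mul_ne_zero (pow_ne_zero 2 hg.skew_ne) (hg.normSq_ne h2)
  trace_ne_skew h := by
    rw [trace_theta, skew_theta] at h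
    have hs := mul_ne_zero hg.skew_ne (hg.normSq_ne h2)
    apply hg.trace_ne_skew
    apply mul_left_cancel₀ hs
    linear_combination -h + (1 + skew g * normSq (symPart g) * g.1.trace) * h2

theorem iterate (h2 : (2 : F) = 0) (hg : IsPersistentTwo g) (n : ℕ) :
    IsPersistentTwo ((EventualOrbit.theta (stdElt F))^[n] g) := by
  induction n with
  | zero => exact hg
  | succ n ih => rw [Function.iterate_succ_apply']; exact ih.theta h2

theorem ne_one (hg : IsPersistentTwo g) : g ≠ 1 := by
  rintro rfl
  exact hg.skew_ne skew_one

theorem ratio_theta (h2 : (2 : F) = 0) (hg : IsPersistentTwo g) :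
    (EventualOrbit.theta (stdElt F) g).1.trace / skew (EventualOrbit.theta (stdElt F) g) =
      (g.1.trace / skew g)⁻¹ := by
  have h1 := hg.skew_ne
  have h3 := hg.trace_ne
  have h4 := hg.normSq_ne h2
  rw [trace_theta, skew_theta, h2, zero_add, inv_div,
    div_eq_div_iff (neg_ne_zero.2 (mul_ne_zero (mul_ne_zero h1 h3) h4)) h3]
  linear_combination (skew g ^ 2 * normSq (symPart g) * g.1.trace) * h2

theorem ratio_iterate (h2 : (2 : F) = 0) (hg : IsPersistentTwo g) (n : ℕ) :
    let h := (EventualOrbit.theta (stdElt F))^[n] g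
    h.1.trace / skew h = g.1.trace / skew g ∨ h.1.trace / skew h = (g.1.trace / skew g)⁻¹ := by
  induction n with
  | zero => exact Or.inl rfl
  | succ n ih =>
    simp only [Function.iterate_succ_apply', (hg.iterate h2 n).ratio_theta h2] at ih ⊢
    rcases ih with ih | ih
    · exact Or.inr (by rw [ih])
    · exact Or.inl (by rw [ih, inv_inv])

end IsPersistentTwo

theorem card_sub_two_le_two_mul_beta [Finite F] (hF : ringChar F = 2) :
    Nat.card F - 2 ≤ 2 * beta (stdElt F) := by
  have h2 : (2 : F) = 0 := by
    have := ringChar.spec F 2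
    exact_mod_cast this.2 (by rw [hF])
  have hcard : Nat.card F - 2 ≤ Nat.card {r : F // r ≠ 0 ∧ r ≠ 1} := by
    have h1 := Set.ncard_add_ncard_compl ({0, 1} : Set F)
    have h3 : Nat.card {r : F // r ≠ 0 ∧ r ≠ 1} = ({0, 1} : Set F)ᶜ.ncard := by
      rw [← Nat.card_coe_set_eq]
      exact Nat.card_congr (Equiv.subtypeEquivRight fun r => by simp)
    have h4 := ncard_pair_le (0 : F) 1
    omega
  refine hcard.trans ?_
  -- These entries have trace `r` and skew part `1`; with `x = (r - 1)⁻¹` the determinant is `x (r +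
  -- 1 - 2x)`, which is `1` in characteristic two.
  have hdet : ∀ r : {r : F // r ≠ 0 ∧ r ≠ 1},
      (r.1 - 1)⁻¹ * (r - (r.1 - 1)⁻¹) - (r.1 - 1)⁻¹ * ((r.1 - 1)⁻¹ - 1) = 1 := fun r => by
    have := sub_ne_zero.2 r.2.2
    field_simp
    linear_combination (r.1 - 2) * h2
  let g : {r : F // r ≠ 0 ∧ r ≠ 1} → SpecialLinearGroup (Fin 2) F := fun r =>
    ofEntries _ _ _ _ (hdet r)
  have htr : ∀ r, (g r).1.trace = r := fun r => by
    rw [trace_ofEntries]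
    ring
  have hsk : ∀ r, skew (g r) = 1 := fun r => by
    rw [skew_ofEntries]
    ring
  have hper : ∀ r, IsPersistentTwo (g r) := fun r =>
    ⟨by rw [hsk]; exact one_ne_zero, by rw [htr]; exact r.2.1, by rw [htr, hsk]; exact r.2.2⟩
  refine card_le_mul_beta (stdElt F) g 2 (fun r n => ((hper r).iterate h2 n).ne_one)
    (fun r => {r, ⟨r.1⁻¹, inv_ne_zero r.2.1, fun h => r.2.2 (inv_eq_one.1 h)⟩})
    (fun r => ncard_pair_le _ _) fun r t m n hmn => ?_
  have h1 := (hper r).ratio_iterate h2 m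
  have h3 := (hper t).ratio_iterate h2 n
  simp only [hmn, htr, hsk, div_one] at h1 h3
  simp only [Set.mem_insert_iff, Set.mem_singleton_iff, Subtype.ext_iff]
  rcases h1 with h1 | h1 <;> rcases h3 with h3 | h3 <;> rw [h1] at h3
  · exact Or.inl h3.symm
  · exact Or.inr (by rw [h3, inv_inv])
  · exact Or.inr h3.symm
  · exact Or.inl (inv_injective h3.symm)

end LowerBounds

/-! ### Explicit cycles for `q = 4, 5, 7, 9`. -/

section SmallFields

open Matrix

/-- The action of `θ` for `stdElt` on the entries of a matrix of determinant one. -/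
def thetaEntries {R : Type*} [CommRing R] : R × R × R × R → R × R × R × R
  | (a, b, c, d) =>
    ((c ^ 2 + d ^ 2) * (a ^ 2 + c ^ 2) - (a * c + b * d) * (a * b + c * d),
      (c ^ 2 + d ^ 2) * (a * b + c * d) - (a * c + b * d) * (b ^ 2 + d ^ 2),
      (a ^ 2 + b ^ 2) * (a * b + c * d) - (a * c + b * d) * (a ^ 2 + c ^ 2),
      (a ^ 2 + b ^ 2) * (b ^ 2 + d ^ 2) - (a * c + b * d) * (a * b + c * d))

variable {F : Type*} [Field F] [Finite F]

open Fin.NatCast Fin.CommRing in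
/-- Cycles of `θ` given by their matrix entries, over a ring that embeds into `F`. -/
theorem card_cycles_le_beta {R : Type*} [CommRing R] (φ : R →+* F)
    (hφ : Function.Injective φ) {n m : ℕ} [NeZero m] (c : Fin n → Fin m → R × R × R × R)
    (hdet : ∀ i k, (c i k).1 * (c i k).2.2.2 - (c i k).2.1 * (c i k).2.2.1 = 1)
    (hstep : ∀ i k, thetaEntries (c i k) = c i (k + 1)) (hne : ∀ i, c i 0 ≠ (1, 0, 0, 1))
    (hdisj : ∀ i j k, c i 0 = c j k → i = j) : n ≤ beta (stdElt F) := by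
  let g : Fin n → Fin m → SpecialLinearGroup (Fin 2) F := fun i k =>
    ofEntries (φ (c i k).1) (φ (c i k).2.1) (φ (c i k).2.2.1) (φ (c i k).2.2.2) (by
      rw [← map_mul, ← map_mul, ← map_sub, hdet, map_one])
  have hg : ∀ i k, theta (stdElt F) (g i k) = g i (k + 1) := fun i k => by
    rw [theta_stdElt_ofEntries, ofEntries_inj, ← hstep i k]
    simp [thetaEntries]
  have hiter : ∀ i (l : ℕ) k, (theta (stdElt F))^[l] (g i k) = g i (k + l) := fun i l => by
    induction l with
    | zero => intro k; simp
    | succ l ih =>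
      intro k
      rw [Function.iterate_succ_apply, hg, ih]
      rw [Nat.cast_succ, add_assoc, add_comm 1]
  -- From any position one can continue to position `0`, which is why `hne` and `hdisj` need to
  -- inspect only starting points.
  have hback : ∀ l : ℕ, ∃ r : ℕ, ((l : Fin m) + r) = 0 := fun l =>
    ⟨l * (m - 1), by
      have : l + l * (m - 1) = l * m := by
        rw [add_comm, ← Nat.mul_succ, Nat.succ_eq_add_one, Nat.sub_add_cancel (NeZero.one_le (n := m))]
      rw [← Nat.cast_add, this, Nat.cast_mul, Fin.natCast_self, mul_zero]⟩
  have hinj : ∀ i j k l, g i k = g j l → c i k = c j l := fun i j k l h => by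
    obtain ⟨h1, h2, h3, h4⟩ := ofEntries_inj.1 h
    exact Prod.ext (hφ h1) (Prod.ext (hφ h2) (Prod.ext (hφ h3) (hφ h4)))
  have := card_le_mul_beta (stdElt F) (fun i => g i 0) 1 (fun i l h => ?_) (fun i => {i})
    (fun i => by simp) fun i j a b h => ?_
  · simpa using this
  · obtain ⟨r, hr⟩ := hback l
    have h1 := congrArg (theta (stdElt F))^[r] h
    rw [hiter, hiter, zero_add, hr, Function.iterate_fixed (theta_one _), one_eq_ofEntries] at h1
    obtain ⟨h1, h2, h3, h4⟩ := ofEntries_inj.1 h1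
    refine hne i (Prod.ext (hφ ?_) (Prod.ext (hφ ?_) (Prod.ext (hφ ?_) (hφ ?_))))
    · rw [h1, map_one]
    · rw [h2, map_zero]
    · rw [h3, map_zero]
    · rw [h4, map_one]
  · obtain ⟨r, hr⟩ := hback a
    have h1 := congrArg (theta (stdElt F))^[r] h
    simp only [hiter, zero_add, hr] at h1
    exact (hdisj i j _ (hinj _ _ _ _ h1)).symm

theorem two_le_beta_of_card_four (hF : Nat.card F = 4) : 2 ≤ beta (stdElt F) := by
  have := Fintype.ofFinite F
  rw [Nat.card_eq_fintype_card] at hF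
  have h4 : (4 : F) = 0 := by
    have := FiniteField.cast_card_eq_zero F
    rw [hF] at this
    exact_mod_cast this
  have h2 : (2 : F) = 0 := by
    have : (2 : F) * 2 = 0 := by rw [← h4]; norm_num
    simpa using this
  obtain ⟨w, hw0, hw1⟩ : ∃ w : F, w ≠ 0 ∧ w ≠ 1 := by
    by_contra! h
    have : (Finset.univ : Finset F) ⊆ ({0, 1} : Set F).toFinite.toFinset := fun x _ => by
      by_cases hx : x = 0 <;> simp [hx, h x]
    have h1 := Finset.card_le_card this
    rw [Finset.card_univ, hF, ← Set.ncard_eq_toFinset_card _ (Set.toFinite _)] at h1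
    have := ncard_pair_le (0 : F) 1
    omega
  -- Cancel `w (w - 1)` from `w⁴ - w = 0`.
  have hw : w ^ 2 + w + 1 = 0 := by
    have h := FiniteField.pow_card w
    rw [hF] at h
    have h3 := mul_ne_zero hw0 (sub_ne_zero.2 hw1)
    apply mul_left_cancel₀ h3
    linear_combination h
  refine card_cycles_le_beta (RingHom.id F) Function.injective_id
    ![![(w, w, 0, w ^ 2), (w, 0, w ^ 2, w ^ 2)], ![(w, 0, w, w ^ 2), (w ^ 2, 0, w ^ 2, w)]] ?_ ?_ ?_ ?_
  · simp only [Fin.forall_fin_two, cons_val_zero, cons_val_one, cons_val_fin_one]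
    grind
  · simp only [Fin.forall_fin_two, cons_val_zero, cons_val_one, cons_val_fin_one, thetaEntries,
      zero_add, Fin.isValue, show (1 : Fin 2) + 1 = 0 from rfl, Prod.mk.injEq]
    grind
  · simp only [Fin.forall_fin_two, cons_val_zero, cons_val_one, cons_val_fin_one]
    grind
  · simp only [Fin.forall_fin_two, cons_val_zero, cons_val_one, cons_val_fin_one]
    grind

theorem exists_injective_of_card_eq_prime {p : ℕ} (hp : p.Prime) (hF : Nat.card F = p) :
    ∃ φ : ZMod p →+* F, Function.Injective φ := by
  have := Fintype.ofFinite F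
  have := Fact.mk hp
  have : CharP F p := charP_of_card_eq_prime (Nat.card_eq_fintype_card.symm.trans hF)
  exact ⟨ZMod.castHom dvd_rfl F, (ZMod.castHom dvd_rfl F).injective⟩

theorem two_le_beta_of_card_five (hF : Nat.card F = 5) : 2 ≤ beta (stdElt F) := by
  obtain ⟨φ, hφ⟩ := exists_injective_of_card_eq_prime (by norm_num) hF
  refine card_cycles_le_beta φ hφ
    ![![(3, 3, 1, 3), (1, 4, 1, 0)], ![(3, 1, 3, 3), (0, 1, 4, 1)]] ?_ ?_ ?_ ?_ <;>
  decide

theorem three_le_beta_of_card_seven (hF : Nat.card F = 7) : 3 ≤ beta (stdElt F) := by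
  obtain ⟨φ, hφ⟩ := exists_injective_of_card_eq_prime (by norm_num) hF
  refine card_cycles_le_beta φ hφ
    ![![(3, 5, 3, 3), (0, 1, 6, 6), (3, 4, 2, 3), (6, 1, 6, 0)],
      ![(0, 6, 1, 3), (5, 4, 6, 5), (3, 6, 1, 0), (5, 1, 3, 5)],
      ![(0, 6, 1, 6), (3, 3, 5, 3), (6, 6, 1, 0), (3, 2, 4, 3)]] ?_ ?_ ?_ ?_ <;>
  decide

theorem forall_fin_three {P : Fin 3 → Prop} : (∀ i, P i) ↔ P 0 ∧ P 1 ∧ P 2 := by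
  rw [Fin.forall_fin_succ, Fin.forall_fin_two]
  rfl

theorem three_le_beta_of_card_nine (hF : Nat.card F = 9) : 3 ≤ beta (stdElt F) := by
  have := Fintype.ofFinite F
  rw [Nat.card_eq_fintype_card] at hF
  have h9 : (9 : F) = 0 := by
    have := FiniteField.cast_card_eq_zero F
    rw [hF] at this
    exact_mod_cast this
  have h3 : (3 : F) = 0 := by
    have : (3 : F) * 3 = 0 := by rw [← h9]; norm_num
    simpa using this
  have h1 : (1 : F) ≠ 0 := one_ne_zero
  obtain ⟨i, hi⟩ : ∃ i : F, i ^ 2 = -1 := by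
    have := FiniteField.isSquare_neg_one_iff (F := F)
    rw [hF] at this
    obtain ⟨i, hi⟩ := this.2 (by norm_num)
    exact ⟨i, by rw [hi, sq]⟩
  refine card_cycles_le_beta (RingHom.id F) Function.injective_id
    ![![(-1, 0, 1 + i, -1), (-i, -1 + i, 1 - i, 1 + i)],
      ![(-1, 1 - i, 0, -1), (1 - i, 1 + i, -1 - i, i)],
      ![(-1, -1 + i, 0, -1), (1 - i, -1 - i, 1 + i, i)]] ?_ ?_ ?_ ?_
  · simp only [forall_fin_three, Fin.forall_fin_two, cons_val_zero, cons_val_one, cons_val, cons_val_fin_one]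
    constructorm* _ ∧ _ <;> grind
  · simp only [forall_fin_three, Fin.forall_fin_two, cons_val_zero, cons_val_one, cons_val, cons_val_fin_one,
      thetaEntries, zero_add, show (1 : Fin 2) + 1 = 0 from rfl, Prod.mk.injEq]
    constructorm* _ ∧ _ <;> grind
  · simp only [forall_fin_three, cons_val_zero, cons_val_one, cons_val]
    constructorm* _ ∧ _ <;> grind
  · simp only [forall_fin_three, Fin.forall_fin_two, cons_val_zero, cons_val_one, cons_val, cons_val_fin_one,
      Prod.mk.injEq]
    constructorm* _ ∧ _ <;> grind

end SmallFields

/-! ### Unitriangular subgroups and the Sylow property. -/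

section Automorphisms

open Matrix

variable {F : Type*} [Field F] {G : Type*} [Group G]

/-- The upper unitriangular matrix with off-diagonal entry `t`. -/
def upper (t : F) : SpecialLinearGroup (Fin 2) F := ofEntries 1 t 0 1 (by ring)

/-- The lower unitriangular matrix with off-diagonal entry `t`. -/
def lower (t : F) : SpecialLinearGroup (Fin 2) F := ofEntries 1 0 t 1 (by ring)

theorem upper_mul (s t : F) : upper s * upper t = upper (s + t) := by
  simp only [upper, ofEntries_mul, ofEntries_inj]
  refine ⟨?_, ?_, ?_, ?_⟩ <;> ring

theorem lower_mul (s t : F) : lower s * lower t = lower (s + t) := by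
  simp only [lower, ofEntries_mul, ofEntries_inj]
  refine ⟨?_, ?_, ?_, ?_⟩ <;> ring

theorem upper_zero : upper (0 : F) = 1 := one_eq_ofEntries.symm

theorem lower_zero : lower (0 : F) = 1 := one_eq_ofEntries.symm

theorem upper_inv (t : F) : (upper t)⁻¹ = upper (-t) := by
  rw [inv_eq_iff_mul_eq_one, upper_mul, add_neg_cancel, upper_zero]

theorem lower_inv (t : F) : (lower t)⁻¹ = lower (-t) := by
  rw [inv_eq_iff_mul_eq_one, lower_mul, add_neg_cancel, lower_zero]

theorem ofEntries_conj_upper {a b c d : F} (h) (t : F) :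
    ofEntries a b c d h * upper t * (ofEntries a b c d h)⁻¹ =
      ofEntries (1 - a * c * t) (a ^ 2 * t) (-(c ^ 2 * t)) (1 + a * c * t) (by ring) := by
  simp only [upper, ofEntries_inv, ofEntries_mul, ofEntries_inj]
  refine ⟨?_, ?_, ?_, ?_⟩
  · linear_combination h
  · ring
  · ring
  · linear_combination h

theorem ofEntries_conj_upper_of_eq_zero {a b d : F} (h) (t : F) :
    ofEntries a b 0 d h * upper t * (ofEntries a b 0 d h)⁻¹ = upper (a ^ 2 * t) := by
  rw [ofEntries_conj_upper, upper, ofEntries_inj]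
  refine ⟨?_, ?_, ?_, ?_⟩ <;> ring

theorem ofEntries_conj_upper_of_eq_zero' {b c d : F} (h) (t : F) :
    ofEntries 0 b c d h * upper t * (ofEntries 0 b c d h)⁻¹ = lower (-(c ^ 2 * t)) := by
  rw [ofEntries_conj_upper, lower, ofEntries_inj]
  refine ⟨?_, ?_, ?_, ?_⟩ <;> ring

theorem stdElt_conj_upper (t : F) : stdElt F * upper t * (stdElt F)⁻¹ = lower (-t) := by
  rw [stdElt_eq_ofEntries, ofEntries_conj_upper_of_eq_zero']
  congr 1
  ring

/-- Unitriangular matrices generate `SL₂(F)`. -/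
theorem hom_ext_upper_lower {f g : SpecialLinearGroup (Fin 2) F →* G}
    (hu : ∀ t, f (upper t) = g (upper t)) (hl : ∀ t, f (lower t) = g (lower t)) : f = g := by
  have key : ∀ a b c d h, c ≠ 0 → f (ofEntries a b c d h) = g (ofEntries a b c d h) := by
    intro a b c d h hc
    have : ofEntries a b c d h = upper ((a - 1) / c) * lower c * upper ((d - 1) / c) := by
      simp only [upper, lower, ofEntries_mul, ofEntries_inj]
      refine ⟨?_, ?_, ?_, ?_⟩ <;> field_simp
      · ring
      · linear_combination -h
      · ring
      · ring
    rw [this, map_mul, map_mul, map_mul, map_mul, hu, hu, hl]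
  ext1 M
  obtain ⟨a, b, c, d, h, rfl⟩ := exists_ofEntries M
  by_cases hc : c = 0
  · subst hc
    have ha : a ≠ 0 := by
      rintro rfl
      simp at h
    -- Multiplying by `lower 1` makes the lower left entry the nonzero `a`, reducing to `key`.
    have h1 : lower 1 * ofEntries a b 0 d h = ofEntries a b a (b + d) (by linear_combination h) := by
      simp only [lower, ofEntries_mul, ofEntries_inj]
      refine ⟨?_, ?_, ?_, ?_⟩ <;> ring
    have h2 := key a b a (b + d) (by linear_combination h) ha
    rw [← h1, map_mul, map_mul, hl] at h2
    exact mul_left_cancel h2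
  · exact key a b c d h hc

theorem exists_scalar_of_mem_center {a b c d : F} {h}
    (hM : ofEntries a b c d h ∈ Subgroup.center (SpecialLinearGroup (Fin 2) F)) :
    b = 0 ∧ c = 0 ∧ a = d := by
  obtain ⟨r, -, hr⟩ := Matrix.SpecialLinearGroup.mem_center_iff.1 hM
  have h1 : ∀ i j, scalar (Fin 2) r i j = (ofEntries a b c d h).1 i j := fun i j => by rw [hr]
  have h00 := h1 0 0
  have h01 := h1 0 1
  have h10 := h1 1 0
  have h11 := h1 1 1
  simp [ofEntries] at h00 h01 h10 h11
  exact ⟨h01.symm, h10.symm, h00.symm.trans h11⟩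

section Central

variable (π : SpecialLinearGroup (Fin 2) F →* G)

/-- The image of the group of upper unitriangular matrices. -/
def upperSubgroup : Subgroup G where
  carrier := Set.range fun t => π (upper t)
  mul_mem' := by
    rintro _ _ ⟨s, rfl⟩ ⟨t, rfl⟩
    exact ⟨s + t, by simp only [← map_mul, upper_mul]⟩
  one_mem' := ⟨0, by simp only [upper_zero, map_one]⟩
  inv_mem' := by
    rintro _ ⟨t, rfl⟩
    exact ⟨-t, by simp only [← map_inv, upper_inv]⟩

/-- The image of the group of lower unitriangular matrices. -/
def lowerSubgroup : Subgroup G where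
  carrier := Set.range fun t => π (lower t)
  mul_mem' := by
    rintro _ _ ⟨s, rfl⟩ ⟨t, rfl⟩
    exact ⟨s + t, by simp only [← map_mul, lower_mul]⟩
  one_mem' := ⟨0, by simp only [lower_zero, map_one]⟩
  inv_mem' := by
    rintro _ ⟨t, rfl⟩
    exact ⟨-t, by simp only [← map_inv, lower_inv]⟩

variable {π}

theorem entries_of_map_eq_map_upper
    (hker : π.ker ≤ Subgroup.center (SpecialLinearGroup (Fin 2) F))
    {a b c d t : F} {h}
    (e : π (ofEntries a b c d h) = π (upper t)) : c = 0 ∧ b = a * t := by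
  have h1 : ofEntries a b c d h * (upper t)⁻¹ ∈ π.ker := by
    rw [MonoidHom.mem_ker, map_mul, map_inv, e, mul_inv_cancel]
  have h2 := hker h1
  rw [upper_inv, upper, ofEntries_mul] at h2
  obtain ⟨h3, h4, -⟩ := exists_scalar_of_mem_center h2
  exact ⟨by linear_combination h4, by linear_combination h3⟩

theorem entries_of_map_eq_map_lower
    (hker : π.ker ≤ Subgroup.center (SpecialLinearGroup (Fin 2) F))
    {a b c d t : F} {h}
    (e : π (ofEntries a b c d h) = π (lower t)) : b = 0 := by
  have h1 : ofEntries a b c d h * (lower t)⁻¹ ∈ π.ker := by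
    rw [MonoidHom.mem_ker, map_mul, map_inv, e, mul_inv_cancel]
  have h2 := hker h1
  rw [lower_inv, lower, ofEntries_mul] at h2
  obtain ⟨h3, -, -⟩ := exists_scalar_of_mem_center h2
  linear_combination h3

theorem map_upper_injective
    (hker : π.ker ≤ Subgroup.center (SpecialLinearGroup (Fin 2) F)) :
    Function.Injective fun t => π (upper t) := fun s t h => by
  have := (entries_of_map_eq_map_upper hker h).2
  linear_combination this

/-- Over a field of order `q`, `tr (M^q) = (tr M)^q = tr M`. -/
theorem trace_pow_card_pow [Finite F] (M : Matrix (Fin 2) (Fin 2) F) (k : ℕ) :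
    (M ^ Nat.card F ^ k).trace = M.trace := by
  have := Fintype.ofFinite F
  induction k with
  | zero => rw [pow_zero, pow_one]
  | succ k ih =>
    rw [pow_succ, pow_mul, Nat.card_eq_fintype_card, FiniteField.trace_pow_card,
      FiniteField.pow_card, ← Nat.card_eq_fintype_card, ih]

/-- Elements of `p`-power order in a central quotient of `SL₂(F)` lift to matrices of
trace `± 2`. -/
theorem trace_sq_of_pow_eq_one [Finite F]
    (hker : π.ker ≤ Subgroup.center (SpecialLinearGroup (Fin 2) F)) {p : ℕ} (hp : p ∣ Nat.card F)
    (M : SpecialLinearGroup (Fin 2) F) (hM : ∃ k, π M ^ p ^ k = 1) : M.1.trace ^ 2 = 4 := by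
  obtain ⟨k, hk⟩ := hM
  obtain ⟨m, hm⟩ := pow_dvd_pow_of_dvd hp k
  have h1 : M ^ Nat.card F ^ k ∈ π.ker := by
    rw [MonoidHom.mem_ker, map_pow, hm, pow_mul, hk, one_pow]
  obtain ⟨r, hr, hr'⟩ := Matrix.SpecialLinearGroup.mem_center_iff.1 (hker h1)
  have h2 : (scalar (Fin 2) r).trace = M.1.trace := by
    rw [hr']
    exact (congrArg trace (Matrix.SpecialLinearGroup.coe_pow M _)).trans (trace_pow_card_pow M.1 k)
  rw [← h2]
  have h3 : (scalar (Fin 2) r).trace = 2 * r := by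
    rw [trace_fin_two]
    simp [two_mul]
  rw [Fintype.card_fin] at hr
  rw [h3, mul_pow, hr]
  norm_num

theorem isPGroup_upperSubgroup {p : ℕ} [CharP F p] : IsPGroup p (upperSubgroup π) := by
  rintro ⟨_, t, rfl⟩
  have : ∀ n : ℕ, upper t ^ n = upper (n * t) := fun n => by
    induction n with
    | zero => simp [upper_zero]
    | succ n ih =>
      rw [pow_succ, ih, upper_mul]
      congr 1
      push_cast
      ring
  refine ⟨1, Subtype.ext ?_⟩
  simp [← map_pow, this, upper_zero]

/-- This is the maximality that makes `upperSubgroup π` a Sylow subgroup. It rests on the trace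
condition applied to every `upper t * M`. -/
theorem le_upperSubgroup_of_isPGroup [Finite F] (hπ : Function.Surjective π)
    (hker : π.ker ≤ Subgroup.center (SpecialLinearGroup (Fin 2) F)) {p : ℕ} [Fact p.Prime]
    [CharP F p] {Q : Subgroup G} (hQ : IsPGroup p Q) (hle : upperSubgroup π ≤ Q) :
    Q ≤ upperSubgroup π := by
  have hp : p ∣ Nat.card F := by
    rw [← CharP.cast_eq_zero_iff F p]
    have := Fintype.ofFinite F
    rw [Nat.card_eq_fintype_card, FiniteField.cast_card_eq_zero]
  have htor : ∀ g ∈ Q, ∃ k, g ^ p ^ k = 1 := fun g hg => by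
    obtain ⟨k, hk⟩ := hQ ⟨g, hg⟩
    exact ⟨k, congrArg Subtype.val hk⟩
  intro g hg
  obtain ⟨M, rfl⟩ := hπ g
  obtain ⟨a, b, c, d, h, rfl⟩ := exists_ofEntries M
  have htr : ∀ t, (a + d + t * c) ^ 2 = 4 := fun t => by
    have h1 : π (upper t * ofEntries a b c d h) ∈ Q := by
      rw [map_mul]
      exact Q.mul_mem (hle ⟨t, rfl⟩) hg
    have h2 := trace_sq_of_pow_eq_one hker hp _ (htor _ h1)
    rw [upper, ofEntries_mul, trace_ofEntries] at h2
    rw [← h2]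
    ring
  have hc : c = 0 := by
    by_contra hc
    -- For `c ≠ 0` the trace takes every value as `t` varies; the values `0` and `1` cannot both
    -- square to `4`.
    have h0 := htr (-(a + d) / c)
    have h1 := htr ((1 - (a + d)) / c)
    rw [div_mul_cancel₀ _ hc] at h0 h1
    exact one_ne_zero (α := F) (by linear_combination h1 - h0)
  subst hc
  have h0 := htr 0
  have had : a = d := by
    rw [← sub_eq_zero, ← sq_eq_zero_iff]
    linear_combination h0 - 4 * h
  subst had
  have ha : a * a = 1 := by linear_combination h
  have hM : ofEntries a b 0 a h = ofEntries a 0 0 a (by linear_combination ha) * upper (a * b) := by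
    rw [upper, ofEntries_mul, ofEntries_inj]
    refine ⟨?_, ?_, ?_, ?_⟩
    · ring
    · linear_combination -b * ha
    · ring
    · ring
  -- In characteristic two the scalar is `1`; otherwise its image has order dividing both `2` and a
  -- power of the odd prime `p`.
  have hz : π (ofEntries a 0 0 a (by linear_combination ha)) = 1 := by
    rcases (Fact.out : p.Prime).eq_two_or_odd' with rfl | hodd
    · have : a = 1 := by
        have h2 : (2 : F) = 0 := by exact_mod_cast CharP.cast_eq_zero F 2
        rw [← sub_eq_zero, ← sq_eq_zero_iff]
        linear_combination ha + (1 - a) * h2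
      subst this
      rw [← one_eq_ofEntries, map_one]
    · rw [hM, map_mul] at hg
      obtain ⟨k, hk⟩ := htor _ ((Q.mul_mem_cancel_right (hle ⟨a * b, rfl⟩)).1 hg)
      have h2 : π (ofEntries a 0 0 a (by linear_combination ha)) ^ 2 = 1 := by
        rw [← map_pow, sq, ofEntries_mul, ← map_one π, one_eq_ofEntries]
        congr 1
        rw [ofEntries_inj]
        refine ⟨?_, ?_, ?_, ?_⟩
        · linear_combination ha
        · ring
        · ring
        · linear_combination ha
      have h3 := pow_gcd_eq_one.2 ⟨h2, hk⟩
      rwa [(Nat.coprime_two_left.2 (hodd.pow)).gcd_eq_one, pow_one] at h3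
  exact ⟨a * b, by simp only [hM, map_mul, hz, one_mul]⟩

end Central

end Automorphisms

/-! ### Counting automorphisms of a central quotient of `SL₂(F)`. -/

section AutomorphismCount

open Matrix

variable {F : Type*} [Field F] {G : Type*} [Group G]
  {π : SpecialLinearGroup (Fin 2) F →* G}

theorem exists_conj_eq_aut_upperSubgroup [Finite F] [Finite G] (hπ : Function.Surjective π)
    (hker : π.ker ≤ Subgroup.center (SpecialLinearGroup (Fin 2) F)) (φ : MulAut G) :
    ∃ g : G, ∀ x ∈ upperSubgroup π, g⁻¹ * φ x * g ∈ upperSubgroup π := by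
  obtain ⟨p, hp⟩ := CharP.exists F
  have : Fact p.Prime := ⟨(CharP.char_is_prime_or_zero F p).resolve_right
    (CharP.char_ne_zero_of_finite F p)⟩
  let P : Sylow p G :=
    { upperSubgroup π with
      isPGroup' := isPGroup_upperSubgroup
      is_maximal' := fun {Q} hQ hle => le_antisymm (le_upperSubgroup_of_isPGroup hπ hker hQ hle) hle }
  obtain ⟨g, hg⟩ := MulAction.exists_smul_eq G P (φ • P)
  refine ⟨g, fun x hx => ?_⟩
  have h1 : φ x ∈ (φ • P : Sylow p G) := ⟨x, hx, rfl⟩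
  rw [← hg] at h1
  obtain ⟨y, hy, hy'⟩ := h1
  have h2 : g * y * g⁻¹ = φ x := hy'
  rw [← h2]
  have hy1 : y ∈ upperSubgroup π := hy
  simpa [mul_assoc] using hy1

/-- Representatives of the cosets of the upper triangular group. -/
def cosetRep (π : SpecialLinearGroup (Fin 2) F →* G) : Option F → G
  | none => 1
  | some t => π (upper t) * π (stdElt F)

theorem map_lower_eq (t : F) : π (lower t) = π (stdElt F) * π (upper (-t)) * (π (stdElt F))⁻¹ := by
  rw [← map_mul, ← map_inv, ← map_mul, stdElt_conj_upper, neg_neg]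

/-- By the Bruhat decomposition the Sylow conjugator is a representative times an upper triangular
matrix, and the latter normalises `upperSubgroup π`. This leaves `q + 1` conjugators. -/
theorem exists_cosetRep [Finite F] [Finite G] (hπ : Function.Surjective π)
    (hker : π.ker ≤ Subgroup.center (SpecialLinearGroup (Fin 2) F)) (φ : MulAut G) :
    ∃ o, ∀ x ∈ upperSubgroup π, (cosetRep π o)⁻¹ * φ x * cosetRep π o ∈ upperSubgroup π := by
  obtain ⟨g, hg⟩ := exists_conj_eq_aut_upperSubgroup hπ hker φ
  obtain ⟨M, rfl⟩ := hπ g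
  obtain ⟨a, b, c, d, h, rfl⟩ := exists_ofEntries M
  by_cases hc : c = 0
  · subst hc
    refine ⟨none, fun x hx => ?_⟩
    obtain ⟨t, ht⟩ := hg x hx
    refine ⟨a ^ 2 * t, ?_⟩
    have h1 := congrArg (fun y => π (ofEntries a b 0 d h) * y * (π (ofEntries a b 0 d h))⁻¹) ht
    simp only [← map_inv, ← map_mul, ofEntries_conj_upper_of_eq_zero] at h1
    simp only [cosetRep, h1]
    simp [mul_assoc]
  · refine ⟨some (a / c), fun x hx => ?_⟩
    obtain ⟨t, ht⟩ := hg x hx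
    have hM : ofEntries a b c d h =
        upper (a / c) * stdElt F * ofEntries (-c) (-d) 0 (-c⁻¹) (by field_simp; ring) := by
      simp only [upper, stdElt_eq_ofEntries, ofEntries_mul, ofEntries_inj]
      refine ⟨?_, ?_, ?_, ?_⟩ <;> field_simp
      · ring
      · linear_combination -c * h
      · ring
      · ring
    have h2 := ofEntries_conj_upper_of_eq_zero (a := -c) (b := -d) (d := -c⁻¹)
      (by field_simp; ring) t
    generalize ofEntries (-c) (-d) 0 (-c⁻¹) _ = N at hM h2
    refine ⟨(-c) ^ 2 * t, ?_⟩
    have h1 := congrArg (fun y => π N * y * (π N)⁻¹) ht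
    simp only [← map_inv, ← map_mul, h2] at h1
    simp only [cosetRep, h1, hM]
    simp [mul_assoc]

/-- The automorphisms preserving the images of both unitriangular groups. -/
def PreservesPair (π : SpecialLinearGroup (Fin 2) F →* G) (ψ : MulAut G) : Prop :=
  (∀ x ∈ upperSubgroup π, ψ x ∈ upperSubgroup π) ∧ ∀ x ∈ lowerSubgroup π, ψ x ∈ lowerSubgroup π

theorem exists_preservesPair [Finite F] [Finite G] (hπ : Function.Surjective π)
    (hker : π.ker ≤ Subgroup.center (SpecialLinearGroup (Fin 2) F)) {φ : MulAut G}
    (hφ : ∀ x ∈ upperSubgroup π, φ x ∈ upperSubgroup π) :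
    ∃ t, PreservesPair π ((MulAut.conj (π (upper t)))⁻¹ * φ) := by
  -- The lower subgroup is the `stdElt F`-conjugate of the upper one, so its image is again a
  -- conjugate by some representative. The representative `1` is impossible, since the upper
  -- subgroup already fills its own image.
  obtain ⟨o, ho⟩ := exists_cosetRep hπ hker (φ * MulAut.conj (π (stdElt F)))
  have hl : ∀ x ∈ lowerSubgroup π, (cosetRep π o)⁻¹ * φ x * cosetRep π o ∈ upperSubgroup π := by
    rintro _ ⟨t, rfl⟩
    have := ho _ ⟨-t, rfl⟩
    rw [MulAut.mul_apply, MulAut.conj_apply, ← map_lower_eq] at this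
    exact this
  have hconj : ∀ g x : G, (MulAut.conj g)⁻¹ x = g⁻¹ * x * g := fun g x => by
    rw [← map_inv, MulAut.conj_apply, inv_inv]
  cases o with
  | none =>
    exfalso
    have h1 : φ (π (lower 1)) ∈ upperSubgroup π := by
      simpa [cosetRep] using hl _ ⟨1, rfl⟩
    have h2 : Function.Surjective fun x : upperSubgroup π =>
        (⟨φ x, hφ x x.2⟩ : upperSubgroup π) :=
      Finite.surjective_of_injective fun x y hxy =>
        Subtype.ext (φ.injective (congrArg Subtype.val hxy))
    obtain ⟨⟨x, t, rfl⟩, hx⟩ := h2 ⟨_, h1⟩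
    have h3 := φ.injective (congrArg Subtype.val hx)
    exact one_ne_zero (entries_of_map_eq_map_upper hker h3.symm).1
  | some t =>
    refine ⟨t, fun x hx => ?_, fun x hx => ?_⟩
    · rw [MulAut.mul_apply, hconj]
      have := (upperSubgroup π).mul_mem (hφ x hx) ⟨t, rfl⟩
      have := (upperSubgroup π).mul_mem ((upperSubgroup π).inv_mem ⟨t, rfl⟩) this
      rwa [← mul_assoc] at this
    · rw [MulAut.mul_apply, hconj]
      obtain ⟨s, hs⟩ := hl x hx
      refine ⟨-s, ?_⟩
      simp only [map_lower_eq, neg_neg]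
      simp only at hs
      rw [hs]
      simp [cosetRep, mul_assoc]

/-- In a finite field the squares generate the additive group. -/
theorem induction_on_squares [Finite F] {P : F → Prop} (hsq : ∀ s, P (s ^ 2))
    (hsub : ∀ a b, P a → P b → P (a - b)) (a : F) : P a := by
  by_cases h : ringChar F = 2
  · obtain ⟨s, rfl⟩ := FiniteField.isSquare_of_char_two h a
    rw [← sq]
    exact hsq s
  · have h2 : (2 : F) ≠ 0 := Ring.two_ne_zero h
    -- `a = ((a + 1)/2)² - ((a - 1)/2)²`.
    have := hsub _ _ (hsq ((a + 1) / 2)) (hsq ((a - 1) / 2))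
    convert this using 1
    field_simp
    ring

/-- Conjugation by `diag(s, s⁻¹)` multiplies the parameter of `upper` by `s²`. Its `ψ`-image
normalises the upper subgroup, so also acts by a scalar. Thus the induced additive map `α` is
multiplicative on squares up to the factor `α 1`, and additivity extends this to all of `F`. -/
theorem exists_smul_ringEquiv [Finite F]
    (hπ : Function.Surjective π) (hker : π.ker ≤ Subgroup.center (SpecialLinearGroup (Fin 2) F))
    {ψ : MulAut G} (hψ : ∀ x ∈ upperSubgroup π, ψ x ∈ upperSubgroup π) :
    ∃ (m : Fˣ) (σ : F ≃+* F), ∀ t, ψ (π (upper t)) = π (upper (m * σ t)) := by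
  choose α hα using fun t => hψ _ ⟨t, rfl⟩
  simp only at hα
  have hinj := map_upper_injective hker
  have hadd : ∀ s t, α (s + t) = α s + α t := fun s t => hinj (by
    simp only [← upper_mul, map_mul, hα])
  have hαinj : Function.Injective α := fun s t h => hinj (ψ.injective (by
    simp only [← hα, h]))
  have hα0 : α 0 = 0 := by simpa using hadd 0 0
  have h1 : α 1 ≠ 0 := fun h => one_ne_zero (hαinj (h.trans hα0.symm))
  have hsq : ∀ s, ∃ m, ∀ t, α (s ^ 2 * t) = m * α t := fun s => by
    by_cases hs : s = 0
    · exact ⟨0, fun t => by rw [hs]; simp [hα0]⟩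
    obtain ⟨M, hM⟩ := hπ (ψ (π (ofEntries s 0 0 s⁻¹ (by field_simp; ring))))
    obtain ⟨a, b, c, d, h, rfl⟩ := exists_ofEntries M
    have key : ∀ t, π (ofEntries a b c d h * upper (α t) * (ofEntries a b c d h)⁻¹) =
        π (upper (α (s ^ 2 * t))) := fun t => by
      rw [map_mul, map_mul, map_inv, hM, hα, hα, ← map_mul, ← map_inv, ← map_mul, ← map_inv,
        ← map_mul, ← map_mul, ofEntries_conj_upper_of_eq_zero]
    have hc : c = 0 := by
      have := key 1
      rw [ofEntries_conj_upper] at this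
      have := (entries_of_map_eq_map_upper hker this).1
      simpa [h1] using this
    subst hc
    refine ⟨a ^ 2, fun t => ?_⟩
    have := key t
    rw [ofEntries_conj_upper_of_eq_zero] at this
    exact (hinj this).symm
  have hmul : ∀ s t, α (s * t) * α 1 = α s * α t := by
    intro s
    refine induction_on_squares (P := fun s => ∀ t, α (s * t) * α 1 = α s * α t) (fun s t => ?_)
      (fun a b ha hb t => ?_) s
    · obtain ⟨m, hm⟩ := hsq s
      have := hm 1
      rw [mul_one] at this
      rw [hm, this]
      ring
    · have hsub : ∀ a b, α (a - b) = α a - α b := fun a b => by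
        rw [eq_sub_iff_add_eq, ← hadd, sub_add_cancel]
      rw [sub_mul, hsub, hsub]
      linear_combination ha t - hb t
  let σ : F →+* F :=
    { toFun := fun t => α t / α 1
      map_one' := div_self h1
      map_mul' := fun s t => by
        have := hmul s t
        field_simp
        exact this
      map_zero' := by rw [hα0, zero_div]
      map_add' := fun s t => by rw [hadd, add_div] }
  refine ⟨Units.mk0 (α 1) h1, RingEquiv.ofBijective σ (Finite.injective_iff_bijective.1 σ.injective),
    fun t => ?_⟩
  rw [← hα]
  congr 2
  exact (mul_div_cancel₀ (α t) h1).symm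

theorem preservesPair_ext [Finite F]
    (hπ : Function.Surjective π) (hker : π.ker ≤ Subgroup.center (SpecialLinearGroup (Fin 2) F))
    {ψ ψ' : MulAut G} (hψ : PreservesPair π ψ) (hψ' : PreservesPair π ψ')
    (h : ∀ t, ψ (π (upper t)) = ψ' (π (upper t))) : ψ = ψ' := by
  -- `upper (-s⁻¹) * lower s * upper (-s⁻¹)` is antidiagonal, so it conjugates the upper subgroup
  -- into the lower one. Its `ψ`-image does the same, which forces `1 + r * v = 0`: the action on
  -- `lower s` is read off from that on `upper (-s⁻¹)`.
  have key : ∀ {ψ : MulAut G}, PreservesPair π ψ → ∀ {s : F}, s ≠ 0 → ∀ {r : F},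
      ψ (π (upper (-s⁻¹))) = π (upper r) → ψ (π (lower s)) = π (lower (-r⁻¹)) := by
    intro ψ hψ s hs r hr
    obtain ⟨v, hv⟩ := hψ.2 _ ⟨s, rfl⟩
    obtain ⟨k, hk⟩ := hψ.1 _ ⟨1, rfl⟩
    simp only at hv hk
    have hk0 : k ≠ 0 := by
      rintro rfl
      rw [upper_zero, map_one] at hk
      have h1 : π (upper 1) = π (upper 0) := by
        rw [upper_zero, map_one]
        exact ψ.injective (hk.symm.trans (map_one ψ).symm)
      exact one_ne_zero (map_upper_injective hker h1)
    have hn : upper (-s⁻¹) * lower s * upper (-s⁻¹) =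
        ofEntries 0 (-s⁻¹) s 0 (by field_simp; ring) := by
      simp only [upper, lower, ofEntries_mul, ofEntries_inj]
      refine ⟨?_, ?_, ?_, ?_⟩ <;> field_simp <;> ring
    have h1 : ψ (π ((upper (-s⁻¹) * lower s * upper (-s⁻¹)) * upper 1 *
        (upper (-s⁻¹) * lower s * upper (-s⁻¹))⁻¹)) ∈ lowerSubgroup π := by
      rw [hn, ofEntries_conj_upper_of_eq_zero']
      exact hψ.2 _ ⟨_, rfl⟩
    obtain ⟨w, hw⟩ := h1
    have hn' : upper r * lower v * upper r =
        ofEntries (1 + r * v) (r + (1 + r * v) * r) v (1 + v * r) (by ring) := by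
      simp only [upper, lower, ofEntries_mul, ofEntries_inj]
      refine ⟨?_, ?_, ?_, ?_⟩ <;> ring
    simp only [map_mul, map_inv, hr, ← hv, ← hk] at hw
    simp only [← map_mul, ← map_inv] at hw
    rw [hn', ofEntries_conj_upper] at hw
    have h2 := entries_of_map_eq_map_lower hker hw.symm
    have h3 : 1 + r * v = 0 := by simpa [hk0] using h2
    have hr0 : r ≠ 0 := by
      rintro rfl
      simp at h3
    rw [← hv]
    congr 2
    field_simp
    linear_combination h3
  have hl : ∀ s, ψ (π (lower s)) = ψ' (π (lower s)) := fun s => by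
    by_cases hs : s = 0
    · rw [hs, lower_zero, map_one, map_one, map_one]
    · obtain ⟨r, hr⟩ := hψ.1 _ ⟨-s⁻¹, rfl⟩
      rw [key hψ hs hr.symm, key hψ' hs ((h _).symm.trans hr.symm)]
  have := hom_ext_upper_lower (f := ψ.toMonoidHom.comp π) (g := ψ'.toMonoidHom.comp π) h hl
  ext x
  obtain ⟨M, rfl⟩ := hπ x
  exact DFunLike.congr_fun this M

/-- Upper bound for the order of the automorphism group of a central quotient of `SL₂(F)`. -/
theorem card_mulAut_le [Finite F] [Finite G] (hπ : Function.Surjective π)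
    (hker : π.ker ≤ Subgroup.center (SpecialLinearGroup (Fin 2) F)) :
    Nat.card (MulAut G) ≤
      (Nat.card F + 1) * Nat.card F * ((Nat.card F - 1) * Nat.card (F ≃+* F)) := by
  have : Finite (F ≃+* F) := Finite.of_injective _ DFunLike.coe_injective
  have : Finite (MulAut G) := Finite.of_injective _ DFunLike.coe_injective
  have h1 : Nat.card {ψ : MulAut G // PreservesPair π ψ} ≤ (Nat.card F - 1) * Nat.card (F ≃+* F) := by
    choose m σ h using fun ψ : {ψ : MulAut G // PreservesPair π ψ} =>
      exists_smul_ringEquiv hπ hker ψ.2.1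
    rw [← Nat.card_units, ← Nat.card_prod]
    refine Nat.card_le_card_of_injective (fun ψ => (m ψ, σ ψ)) fun ψ ψ' e => ?_
    obtain ⟨e1, e2⟩ := Prod.mk.inj e
    exact Subtype.ext (preservesPair_ext hπ hker ψ.2 ψ'.2 fun t => by rw [h, h, e1, e2])
  have h2 : Function.Surjective fun x : (Option F × F) × {ψ : MulAut G // PreservesPair π ψ} =>
      MulAut.conj (cosetRep π x.1.1) * (MulAut.conj (π (upper x.1.2)) * x.2.1) := by
    intro φ
    obtain ⟨o, ho⟩ := exists_cosetRep hπ hker φ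
    obtain ⟨t, ht⟩ := exists_preservesPair hπ hker (φ := (MulAut.conj (cosetRep π o))⁻¹ * φ)
      fun x hx => by
        rw [MulAut.mul_apply, ← map_inv, MulAut.conj_apply, inv_inv]
        exact ho x hx
    exact ⟨((o, t), ⟨_, ht⟩), by simp⟩
  have h3 := Nat.card_le_card_of_surjective _ h2
  rw [Nat.card_prod, Nat.card_prod, Finite.card_option] at h3
  exact h3.trans (Nat.mul_le_mul_left _ h1)

/-- The field automorphisms of a finite field of order `p ^ f` number at most `f`. -/
theorem exists_prime_pow_card_ringEquiv_le (F : Type*) [Field F] [Finite F] :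
    ∃ p f : ℕ, p.Prime ∧ CharP F p ∧ Nat.card F = p ^ f ∧ Nat.card (F ≃+* F) ≤ f := by
  obtain ⟨p, hp⟩ := CharP.exists F
  have : Fact p.Prime := ⟨(CharP.char_is_prime_or_zero F p).resolve_right
    (CharP.char_ne_zero_of_finite F p)⟩
  let := ZMod.algebra F p
  refine ⟨p, Module.finrank (ZMod p) F, Fact.out, hp, ?_, ?_⟩
  · have := Module.natCard_eq_pow_finrank (K := ZMod p) (V := F)
    rwa [Nat.card_zmod] at this
  · rw [← IsGalois.card_aut_eq_finrank]
    refine Nat.card_le_card_of_injective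
      (fun σ : F ≃+* F => (AlgEquiv.ofRingEquiv (f := σ) fun x =>
        RingHom.congr_fun (Subsingleton.elim ((σ : F →+* F).comp (algebraMap (ZMod p) F))
          (algebraMap (ZMod p) F)) x : F ≃ₐ[ZMod p] F)) fun σ τ h => ?_
    ext x
    exact DFunLike.congr_fun h x

end AutomorphismCount

/-! ### Orders of the two elements, and the numerical comparison with `β^7`. -/

section Bounds

open Matrix

variable {F : Type*} [Field F]

theorem stdElt_sq_mem_center : stdElt F ^ 2 ∈ Subgroup.center (SpecialLinearGroup (Fin 2) F) := by
  rw [Subgroup.mem_center_iff]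
  intro M
  obtain ⟨a, b, c, d, h, rfl⟩ := exists_ofEntries M
  rw [sq, stdElt_eq_ofEntries, ofEntries_mul, ofEntries_mul, ofEntries_mul, ofEntries_inj]
  refine ⟨?_, ?_, ?_, ?_⟩ <;> ring

theorem stdElt_notMem_center : stdElt F ∉ Subgroup.center (SpecialLinearGroup (Fin 2) F) :=
  fun h => one_ne_zero (exists_scalar_of_mem_center (h := by ring) h).1

theorem orderOf_stdElt : orderOf (stdElt F) = 2 ∨ orderOf (stdElt F) = 4 := by
  have h4 : stdElt F ^ 2 ^ 2 = 1 := by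
    rw [show 2 ^ 2 = 2 * 2 from rfl, pow_mul, sq, sq, stdElt_eq_ofEntries, ofEntries_mul,
      ofEntries_mul, one_eq_ofEntries, ofEntries_inj]
    refine ⟨?_, ?_, ?_, ?_⟩ <;> ring
  obtain ⟨k, hk, h⟩ := (Nat.dvd_prime_pow Nat.prime_two).1 (orderOf_dvd_of_pow_eq_one h4)
  have hk0 : k ≠ 0 := by
    rintro rfl
    rw [pow_zero, orderOf_eq_one_iff] at h
    exact stdElt_notMem_center (F := F) (h ▸ one_mem _)
  rw [h]
  obtain rfl | rfl : k = 1 ∨ k = 2 := by omega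
  · exact Or.inl rfl
  · exact Or.inr rfl

theorem orderOf_projStdElt : orderOf (projStdElt F) = 2 := by
  refine orderOf_eq_prime ?_ ?_
  · rw [projStdElt, ← QuotientGroup.mk_pow]
    exact (QuotientGroup.eq_one_iff _).2 stdElt_sq_mem_center
  · exact fun h => stdElt_notMem_center ((QuotientGroup.eq_one_iff _).1 h)

theorem beta_stdElt_le_beta_projStdElt [Finite F] : beta (stdElt F) ≤ beta (projStdElt F) :=
  have : Finite (ProjectiveSpecialLinearGroup (Fin 2) F) := Quotient.finite _
  beta_le_beta_map (QuotientGroup.mk' (Subgroup.center (SpecialLinearGroup (Fin 2) F)))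
    (QuotientGroup.ker_mk' _).le (stdElt F)

/-- For `f ≤ 2` the bound `19` on `q` suffices, since `9 * f ≤ 18`; from `f = 3` on, `9 * f ≤ 3 ^
f`. -/
theorem le_div_nine_of_three_pow_le {q f : ℕ} (hq : 19 ≤ q) (h : 3 ^ f ≤ q) : 9 * f ≤ q := by
  rcases Nat.lt_or_ge f 3 with h3 | h3
  · omega
  · refine le_trans ?_ h
    induction f, h3 using Nat.le_induction with
    | base => norm_num
    | succ n hn ih =>
      have := ih ((Nat.pow_le_pow_right (by norm_num) n.le_succ).trans h)
      rw [pow_succ]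
      omega

theorem le_div_four_of_two_pow_eq {q f : ℕ} (hq : 16 ≤ q) (h : q = 2 ^ f) : 4 * f ≤ q := by
  subst h
  have h4 : 4 ≤ f := by
    by_contra! hf
    have := Nat.pow_le_pow_right (n := 2) (by norm_num) (Nat.le_of_lt_succ hf)
    omega
  clear hq
  induction f, h4 using Nat.le_induction with
  | base => norm_num
  | succ n hn ih =>
    rw [pow_succ]
    omega

/-- Each of `q + 1`, `q`, `q - 1` and `k * f` is at most `c * b`, so the product times `k` is at
most `(c * b)^4`. -/
theorem mul_le_pow_seven {q f b c k : ℕ} (hq : q + 1 ≤ c * b) (hf : k * f ≤ q) (hk : 0 < k)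
    (hb : c ^ 4 ≤ k * b ^ 3) : (q + 1) * q * ((q - 1) * f) ≤ b ^ 7 := by
  refine Nat.le_of_mul_le_mul_left ?_ hk
  calc k * ((q + 1) * q * ((q - 1) * f)) = (q + 1) * q * ((q - 1) * (k * f)) := by ring
    _ ≤ (c * b) * (c * b) * ((c * b) * (c * b)) :=
      Nat.mul_le_mul (Nat.mul_le_mul hq (by omega)) (Nat.mul_le_mul (by omega) (by omega))
    _ = c ^ 4 * b ^ 4 := by ring
    _ ≤ k * b ^ 3 * b ^ 4 := Nat.mul_le_mul_right _ hb
    _ = k * b ^ 7 := by ring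

theorem automorphism_bound_le_beta_pow [Finite F] (hq : 4 ≤ Nat.card F) :
    (Nat.card F + 1) * Nat.card F * ((Nat.card F - 1) * Nat.card (F ≃+* F)) ≤
      beta (stdElt F) ^ 7 := by
  obtain ⟨p, f, hp, hC, hF, hf⟩ := exists_prime_pow_card_ringEquiv_le F
  refine (Nat.mul_le_mul_left _ (Nat.mul_le_mul_left _ hf)).trans ?_
  have hpr : p = ringChar F := CharP.eq F hC (ringChar.charP F)
  have hpow : ∀ {b : ℕ}, b ≤ beta (stdElt F) → b ^ 7 ≤ beta (stdElt F) ^ 7 :=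
    fun h => Nat.pow_le_pow_left h 7
  by_cases h2 : ringChar F = 2
  · have hb := card_sub_two_le_two_mul_beta h2
    have h4 := two_le_beta_of_card_four (F := F)
    obtain rfl : p = 2 := hpr.trans h2
    generalize beta (stdElt F) = b at *
    by_cases h16 : 16 ≤ Nat.card F
    · have := le_div_four_of_two_pow_eq h16 hF
      have h7 : 7 ^ 3 ≤ b ^ 3 := Nat.pow_le_pow_left (by omega) 3
      exact mul_le_pow_seven (c := 3) (k := 4) (by omega) this (by norm_num) (by omega)
    · have hf4 : f < 4 := by
        by_contra! h
        have := Nat.pow_le_pow_right (n := 2) (by norm_num) h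
        omega
      rw [hF] at hq hb h4 ⊢
      interval_cases f
      · omega
      · omega
      · exact le_trans (by norm_num) (hpow (h4 rfl))
      · exact le_trans (by norm_num) (hpow (show 3 ≤ b by omega))
  · have hf1 : (Nat.card F).Prime → f = 1 := fun h => by
      rw [hF] at h
      exact h.eq_one_of_pow
    have h3p : 3 ≤ p := by
      have := hp.two_le
      omega
    have h3 : 3 ^ f ≤ Nat.card F := hF ▸ Nat.pow_le_pow_left h3p f
    have hodd : Nat.card F % 2 = 1 := by
      have := Fintype.ofFinite F
      rw [Nat.card_eq_fintype_card]
      exact FiniteField.odd_card_of_char_ne_two h2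
    have hb := card_sub_two_le_four_mul_beta h2
    have h5 := two_le_beta_of_card_five (F := F)
    have h7 := three_le_beta_of_card_seven (F := F)
    have h9 := three_le_beta_of_card_nine (F := F)
    generalize beta (stdElt F) = b at *
    generalize Nat.card F = q at *
    clear hF
    by_cases h19 : 19 ≤ q
    · have := le_div_nine_of_three_pow_le h19 h3
      have hb' := hb (by omega)
      have h125 : 5 ^ 3 ≤ b ^ 3 := Nat.pow_le_pow_left (by omega) 3
      exact mul_le_pow_seven (c := 5) (k := 9) (by omega) this (by norm_num) (by omega)
    · have hf2 : f ≤ 2 := by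
        by_contra! h
        have := Nat.pow_le_pow_right (n := 3) (by norm_num) h
        omega
      obtain rfl | rfl | rfl | rfl | rfl | rfl | rfl :
          q = 5 ∨ q = 7 ∨ q = 9 ∨ q = 11 ∨ q = 13 ∨ q = 15 ∨ q = 17 := by omega
      · rw [hf1 (by norm_num)]
        exact le_trans (by norm_num) (hpow (h5 rfl))
      · rw [hf1 (by norm_num)]
        exact le_trans (by norm_num) (hpow (h7 rfl))
      · exact le_trans (by omega) (hpow (h9 rfl))
      · rw [hf1 (by norm_num)]
        exact le_trans (by norm_num) (hpow (show 3 ≤ b by omega))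
      -- The tightest case, `q = 13`: `14 · 13 · 12 = 2184`, while `3^7 = 2187`.
      · rw [hf1 (by norm_num)]
        exact le_trans (by norm_num) (hpow (show 3 ≤ b by omega))
      -- That `15` is not a prime power does not matter: the inequality holds for every `f ≤ 2`.
      · exact le_trans (by omega) (hpow (show 4 ≤ b by omega))
      · exact le_trans (by omega) (hpow (show 4 ≤ b by omega))

end Bounds

end EventualOrbit

theorem lemma5 (q : ℕ) (hq : 4 ≤ q) (F : Type*) [Field F] [Finite F] (hF : Nat.card F = q) :
    (∀ κ : ℝ,
      (∀ u : Matrix.SpecialLinearGroup (Fin 2) F, orderOf u = 2 ∨ orderOf u = 4 →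
        (EventualOrbit.beta u : ℝ) ≤ κ) →
      (Nat.card (MulAut (Matrix.SpecialLinearGroup (Fin 2) F)) : ℝ) ≤ κ ^ 7) ∧
    (∀ κ : ℝ,
      (∀ u : Matrix.ProjectiveSpecialLinearGroup (Fin 2) F, orderOf u = 2 ∨ orderOf u = 4 →
        (EventualOrbit.beta u : ℝ) ≤ κ) →
      (Nat.card (MulAut (Matrix.ProjectiveSpecialLinearGroup (Fin 2) F)) : ℝ) ≤ κ ^ 7) ∧
    (ringChar F = 2 →
      ((q : ℝ) - 2) / 2 ≤ (EventualOrbit.beta (EventualOrbit.stdElt F) : ℝ) ∧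
      ((q : ℝ) - 2) / 2 ≤ (EventualOrbit.beta (EventualOrbit.projStdElt F) : ℝ)) ∧
    (ringChar F ≠ 2 →
      ((q : ℝ) - 5) / 4 ≤ (EventualOrbit.beta (EventualOrbit.stdElt F) : ℝ) ∧
      ((q : ℝ) - 5) / 4 ≤ (EventualOrbit.beta (EventualOrbit.projStdElt F) : ℝ)) := by
  subst hF
  have hcmp : (EventualOrbit.beta (EventualOrbit.stdElt F) : ℝ) ≤
      EventualOrbit.beta (EventualOrbit.projStdElt F) := by
    exact_mod_cast EventualOrbit.beta_stdElt_le_beta_projStdElt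
  have hbound : ∀ (n : ℕ) (κ : ℝ), (EventualOrbit.beta (EventualOrbit.stdElt F) : ℝ) ≤ κ →
      n ≤ (Nat.card F + 1) * Nat.card F * ((Nat.card F - 1) * Nat.card (F ≃+* F)) →
      (n : ℝ) ≤ κ ^ 7 := fun n κ hκ hn => by
    have h1 : (n : ℝ) ≤ (EventualOrbit.beta (EventualOrbit.stdElt F) : ℝ) ^ 7 := by
      exact_mod_cast hn.trans (EventualOrbit.automorphism_bound_le_beta_pow hq)
    exact h1.trans (pow_le_pow_left₀ (Nat.cast_nonneg _) hκ 7)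
  refine ⟨fun κ hκ => ?_, fun κ hκ => ?_, fun h2 => ?_, fun h2 => ?_⟩
  · refine hbound _ κ (hκ _ EventualOrbit.orderOf_stdElt) ?_
    exact EventualOrbit.card_mulAut_le (π := MonoidHom.id _) Function.surjective_id (by
      rw [MonoidHom.ker_id]
      exact bot_le)
  · refine hbound _ κ (hcmp.trans (hκ _ (Or.inl EventualOrbit.orderOf_projStdElt))) ?_
    have : Finite (Matrix.ProjectiveSpecialLinearGroup (Fin 2) F) := Quotient.finite _
    exact EventualOrbit.card_mulAut_le (QuotientGroup.mk'_surjective _)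
      (QuotientGroup.ker_mk' _).le
  · have h : ((Nat.card F : ℝ) - 2) / 2 ≤ EventualOrbit.beta (EventualOrbit.stdElt F) := by
      have h1 := EventualOrbit.card_sub_two_le_two_mul_beta h2
      have h3 : (Nat.card F : ℝ) ≤ 2 * EventualOrbit.beta (EventualOrbit.stdElt F) + 2 := by
        exact_mod_cast Nat.sub_le_iff_le_add.1 h1
      linarith
    exact ⟨h, h.trans hcmp⟩
  · have h : ((Nat.card F : ℝ) - 5) / 4 ≤ EventualOrbit.beta (EventualOrbit.stdElt F) := by
      -- An odd `q` below `7` is at most `5`, where the claimed bound is not positive.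
      rcases Nat.lt_or_ge (Nat.card F) 7 with h7 | h7
      · have hodd : Nat.card F % 2 = 1 := by
          have := Fintype.ofFinite F
          rw [Nat.card_eq_fintype_card]
          exact FiniteField.odd_card_of_char_ne_two h2
        have h5 : (Nat.card F : ℝ) ≤ 5 := by exact_mod_cast (by omega : Nat.card F ≤ 5)
        have := Nat.cast_nonneg (α := ℝ) (EventualOrbit.beta (EventualOrbit.stdElt F))
        linarith
      · have h1 := EventualOrbit.card_sub_two_le_four_mul_beta h2 h7
        have h3 : (Nat.card F : ℝ) ≤ 4 * EventualOrbit.beta (EventualOrbit.stdElt F) + 2 := by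
          exact_mod_cast Nat.sub_le_iff_le_add.1 h1
        linarith
    exact ⟨h, h.trans hcmp⟩
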